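/- For $d \ge 2$ and $w \in \mathbb{R}^d$ let $$\mathcal{R}(w) = \frac{1}{d-1}\sum_{i > j} |w_i - w_j|, \qquad \operatorname{prox}_{\mathcal{R}}(x) = \operatorname*{arg\,min}_{u \in \mathbb{R}^d} \Big(\mathcal{R}(u) + \tfrac12 \|u - x\|_2^2\Big).$$ **Algorithm.** SearchCollisions works on arrays $(x, v, m)$ of positions $x_i \in \mathbb{R}$, velocities $v_i \in \mathbb{R}$ and masses $m_i \in \mathbb{N}$. - *SearchCollisions*$(x,v,m)$: return if the size is $1$. Otherwise append zeros until the size $n$ is a power of two, call SearchCollisions on the two halves in parallel, and then call Merge on the whole. - *RightmostCollision*$(i)$: return the first index $j \ge i$ that minimizes $\sum_{k=i}^{j} m_k (x_k + v_k) \big/ \sum_{k=i}^{j} m_k$, where the quotient counts as $+\infty$ if $\sum_{k=i}^{j} m_k = 0$. It is computed by two parallel prefix sums, an elementwise division and a parallel argmin. - *Merge*, on arrays of size $n$: set $le = 1$ and $ri = \frac n2 + 1$. Repeat $\log_2 n - 1$ times: let $mid = \lfloor (le + ri - 1)/2 \rfloor$; if RightmostCollision$(mid) \ge \frac n2 + 1$,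 set $ri = mid + 1$, and otherwise set $le = mid + 1$. Finally let $j$ be RightmostCollision$(le)$, and if $j > le$, call PerformCollisions$(le, j)$. - *PerformCollisions*$(i,j)$: replace $x_i$ and $v_i$ by the averages of $x_i, \dots, x_j$ and $v_i, \dots, v_j$ weighted by $m_i, \dots, m_j$, replace $m_i$ by $m_i + \dots + m_j$, and set $m_{i+1} = \dots = m_j = 0$. The sums are computed by parallel reduction. **Cost model.** A computation is a fork-join computation graph of basic operations, each with at most two operands (arithmetic and comparison of reals and of indices, and writing a word to memory). Its *work* is the total number of basic operations, and its *depth* is the maximal number of them on a chain of operations that must be performed one after the other. Forking, joining and addressing slices of arrays are free. In one time step of a PRAM with $p$ processors, each processor performs at most one basic operation whose operands are available from earlier steps. Prefix sums, reductions and argmin are computed in balanced binary trees. **Claim.** There is a constant $C > 0$ such that the following holds for every $d \ge 2$ and every sorted $x \in \mathbb{R}^d$, $x_1 \le \dots \le x_d$. Run SearchCollisions on $(x, v, m)$ with $v_i = \frac{d - 2i + 1}{d-1}$ and $m_i = 1$ for $1 \le i \le d$. 1. *(Correctness.)* The objective defining $\operatorname{prox}_{\mathcal{R}}(x)$ has a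 unique minimizer, and if $(x', v', m')$ is the output, then the sequence in which each $x'_i + v'_i$ is repeated $m'_i$ times, in the order of $i$, is $\operatorname{prox}_{\mathcal{R}}(x)$. 2. *(Work and depth.)* The work is at most $C\, d \log_2^2 d$, and the depth is at most $C \log_2^3 d$. 3. *(Parallel time.)* For every $p \ge 1$, the computation finishes, with the same output, on a PRAM with $p$ processors after at most $C \big( \frac{d \log_2^2 d}{p} + \log_2^3 d \big)$ time steps. -/

import Mathlib

noncomputable section

/-! ## The regularizer and its proximal mapping -/

/-- The weight-sharing regularizer `R(w) = (1 / (d - 1)) * ∑_{i > j} |w i - w j|`. -/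
def weightSharingReg (d : ℕ) (w : EuclideanSpace ℝ (Fin d)) : ℝ :=
  (1 / ((d : ℝ) - 1)) * ∑ i : Fin d, ∑ j ∈ Finset.univ.filter (fun j : Fin d => j < i), |w i - w j|

/-- `u = prox_f(x)`: the point `u` is the one and only minimizer of
`z ↦ f z + (1 / 2) * ‖z - x‖ ^ 2`, the norm being the Euclidean one. -/
def IsProx {d : ℕ} (f : EuclideanSpace ℝ (Fin d) → ℝ) (x u : EuclideanSpace ℝ (Fin d)) : Prop :=
  ∀ z : EuclideanSpace ℝ (Fin d), z ≠ u →
    f u + (1 / 2) * ‖u - x‖ ^ 2 < f z + (1 / 2) * ‖z - x‖ ^ 2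

/-! ## Parallel computations: basic operations, work, depth, execution on `p` processors -/

/-- The basic operations of the machine (a real RAM instruction set). Each has at most two
operands, produces one machine word (a real, possibly `+∞`, an index or a truth value), and takes
one time step of one processor. The type index is the type of the word that is produced. -/
inductive Prim : Type → Type
  /-- write a real constant to memory -/
  | rstore (a : ℝ) : Prim ℝ
  | radd (a b : ℝ) : Prim ℝ
  | rmul (a b : ℝ) : Prim ℝ
  | rdiv (a b : ℝ) : Prim ℝ
  /-- convert a natural number to a real -/
  | cast (n : ℕ) : Prim ℝ
  /-- total `a` divided by total mass `n`; the value is `+∞` if the mass is zero -/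
  | mean (a : ℝ) (n : ℕ) : Prim (WithTop ℝ)
  | lt (a b : WithTop ℝ) : Prim Bool
  /-- write a natural number constant to memory -/
  | nstore (n : ℕ) : Prim ℕ
  | nadd (a b : ℕ) : Prim ℕ
  | nsub (a b : ℕ) : Prim ℕ
  /-- halve, rounding down -/
  | nhalf (a : ℕ) : Prim ℕ
  | nlt (a b : ℕ) : Prim Bool

/-- The result of a basic operation. -/
def Prim.eval : {α : Type} → Prim α → α
  | _, .rstore a => a
  | _, .radd a b => a + b
  | _, .rmul a b => a * b
  | _, .rdiv a b => a / b
  | _, .cast n => (n : ℝ)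
  | _, .mean a n => if n = 0 then ⊤ else ((a / (n : ℝ) : ℝ) : WithTop ℝ)
  | _, .lt a b => decide (a < b)
  | _, .nstore n => n
  | _, .nadd a b => a + b
  | _, .nsub a b => a - b
  | _, .nhalf a => a / 2
  | _, .nlt a b => decide (a < b)

/-- Fork-join parallel computations with a result in `α`, that is, computation graphs whose nodes
are basic operations:
* `pure a` has finished with the result `a`;
* `op o k` performs the basic operation `o` and then continues with `k` applied to its result;
* `both c c' k` performs `c` and `c'` in parallel (independently of each other) and, when both have
  finished, continues with `k` applied to their results. -/
inductive Par : Type → Type 1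
  | pure {α : Type} (a : α) : Par α
  | op {α β : Type} (o : Prim β) (k : β → Par α) : Par α
  | both {α β γ : Type} (c : Par β) (c' : Par γ) (k : β → γ → Par α) : Par α

namespace Par

/-- Sequential composition. -/
def bind : {α β : Type} → Par α → (α → Par β) → Par β
  | _, _, .pure a, f => f a
  | _, _, .op o k, f => .op o (fun b => bind (k b) f)
  | _, _, .both c c' k, f => .both c c' (fun b b' => bind (k b b') f)

instance : Monad Par where
  pure := Par.pure
  bind := Par.bind

/-- Perform one basic operation and return its result. -/
def prim {α : Type} (o : Prim α) : Par α := .op o .pure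

/-- The result of a computation. -/
def eval : {α : Type} → Par α → α
  | _, .pure a => a
  | _, .op o k => eval (k o.eval)
  | _, .both c c' k => eval (k (eval c) (eval c'))

/-- The work: the total number of basic operations that are performed. -/
def work : {α : Type} → Par α → ℕ
  | _, .pure _ => 0
  | _, .op o k => 1 + work (k o.eval)
  | _, .both c c' k => work c + work c' + work (k (eval c) (eval c'))

/-- The depth: the number of basic operations on a longest chain of operations that have to be
performed one after the other. -/
def depth : {α : Type} → Par α → ℕ
  | _, .pure _ => 0
  | _, .op o k => 1 + depth (k o.eval)
  | _, .both c c' k => max (depth c) (depth c') + depth (k (eval c) (eval c'))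

/-- Carry out all joins both of whose branches have finished; no basic operation is performed.
Afterwards the heads of the unfinished branches are the operations that are ready. -/
def settle : {α : Type} → Par α → Par α
  | _, .pure a => .pure a
  | _, .op o k => .op o k
  | _, .both c c' k =>
    match settle c, settle c' with
    | .pure b, .pure b' => settle (k b b')
    | u, u' => .both u u' k

/-- In a settled computation, let `p` processors perform `p` of the operations that are ready, one
each (all of them if fewer than `p` are ready), the leftmost ones first. Returned are the number of
processors that stayed idle and what is left of the computation. -/
def advance : {α : Type} → ℕ → Par α → ℕ × Par α
  | _, p, .pure a => (p, .pure a)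
  | _, 0, .op o k => (0, .op o k)
  | _, p + 1, .op o k => (p, k o.eval)
  | _, p, .both c c' k =>
    let r := advance p c
    let r' := advance r.1 c'
    (r'.1, .both r.2 r'.2 k)

/-- One synchronous time step of a parallel random access machine with `p` processors: every
processor performs at most one basic operation, and the results are available (in the shared
memory) to all processors from the next time step on. -/
def tick {α : Type} (p : ℕ) (c : Par α) : Par α := settle (advance p c).2

/-- On a parallel random access machine with `p` processors the computation `c` has finished after
`T` time steps, with the result `a`. -/
def RunsIn {α : Type} (p : ℕ) (c : Par α) (T : ℕ) (a : α) : Prop :=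
  (tick p)^[T] (settle c) = .pure a

end Par

/-! ## Map, reduce and scan -/

/-- Apply `f` to all elements of an array in parallel. -/
def parMap {α β : Type} (f : α → Par β) : List α → Par (List β)
  | [] => .pure []
  | a :: l => .both (f a) (parMap f l) (fun b bs => .pure (b :: bs))

/-- Binary trees of partial results. -/
inductive SumTree (α : Type) : Type
  | leaf (a : α) : SumTree α
  | node (s : α) (l r : SumTree α) : SumTree α

/-- The partial result at the root. -/
def SumTree.root {α : Type} : SumTree α → α
  | .leaf a => a
  | .node s _ _ => s

/-- Combine the elements of an array with the binary operation `f` in a balanced binary tree and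
keep all partial results (`e` is used for the empty array only). -/
def upsweep {α : Type} (f : α → α → Par α) (e : α) (l : List α) : Par (SumTree α) :=
  if _h : l.length ≤ 1 then .pure (.leaf (l.headD e))
  else
    .both (upsweep f e (l.take (l.length / 2))) (upsweep f e (l.drop (l.length / 2)))
      (fun t u => do
        let s ← f t.root u.root
        pure (.node s t u))
termination_by l.length
decreasing_by
  all_goals simp only [List.length_take, List.length_drop]
  all_goals omega

/-- From the tree of partial results, the array of all `acc ∘ a₁ ∘ ⋯ ∘ aₖ`. -/
def downsweep {α : Type} (f : α → α → Par α) : α → SumTree α → Par (List α)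
  | acc, .leaf a => do
    let b ← f acc a
    pure [b]
  | acc, .node _ l r => do
    let acc' ← f acc l.root
    .both (downsweep f acc l) (downsweep f acc' r) (fun bs bs' => .pure (bs ++ bs'))

/-- Parallel reduction of an array with an associative operation `f` with identity `e`. -/
def reduce {α : Type} (f : α → α → Par α) (e : α) (l : List α) : Par α := do
  let t ← upsweep f e l
  pure t.root

/-- Parallel (work-efficient, inclusive) scan of a non-empty array with an associative operation
`f` with identity `e`. -/
def scan {α : Type} (f : α → α → Par α) (e : α) (l : List α) : Par (List α) := do
  let t ← upsweep f e l
  downsweep f e t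

def realAdd (a b : ℝ) : Par ℝ := .prim (.radd a b)

def natAdd (a b : ℕ) : Par ℕ := .prim (.nadd a b)

/-- The first index (counted from `0`) at which a non-empty array attains its minimum. -/
def argmin (l : List (WithTop ℝ)) : Par ℕ := do
  let r ← reduce
    (fun (a b : WithTop ℝ × ℕ) => do
      let c ← Par.prim (.lt b.1 a.1)
      pure (if c then b else a))
    (⊤, 0) l.zipIdx
  pure r.2

/-! ## The search collisions algorithm

Arrays are lists and all indices are counted from `0`. Slices and concatenations of neighbouring
blocks are only a matter of addressing; every word that is computed or overwritten costs an
operation. -/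

/-- An entry of the arrays `x`, `v`, `m`: position, velocity and mass of a particle. -/
structure Particle where
  x : ℝ
  v : ℝ
  m : ℕ

/-- Merge the particles `i, …, j` into one particle, which is put in slot `i` and has their total
mass, their centre of mass as position, and their mean velocity; the slots `i + 1, …, j` get mass
zero. -/
def performCollisions (P : List Particle) (i j : ℕ) : Par (List Particle) := do
  let seg := (P.drop i).take (j + 1 - i)
  let mTotal ← reduce natAdd 0 (seg.map Particle.m)
  let mReal ← Par.prim (.cast mTotal)
  let xm ← parMap (fun q => do
    let c ← Par.prim (.cast q.m)
    Par.prim (.rmul q.x c)) seg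
  let xSum ← reduce realAdd 0 xm
  let xNew ← Par.prim (.rdiv xSum mReal)
  let vm ← parMap (fun q => do
    let c ← Par.prim (.cast q.m)
    Par.prim (.rmul q.v c)) seg
  let vSum ← reduce realAdd 0 vm
  let vNew ← Par.prim (.rdiv vSum mReal)
  let cleared ← parMap (fun q => do
    let z ← Par.prim (.nstore 0)
    pure (Particle.mk q.x q.v z)) seg.tail
  pure (P.take i ++ Particle.mk xNew vNew mTotal :: cleared ++ P.drop (j + 1))

/-- The index `j ≥ i` (the first one in case of ties) that minimizes the average destination, by
mass, of the particles `i, …, j`; averages over total mass zero count as `+∞`. -/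
def rightmostCollision (P : List Particle) (i : ℕ) : Par ℕ := do
  let suffix := P.drop i
  let ym ← parMap (fun q => do
    let y ← Par.prim (.radd q.x q.v)
    let c ← Par.prim (.cast q.m)
    Par.prim (.rmul y c)) suffix
  let yCumsum ← scan realAdd 0 ym
  let mCumsum ← scan natAdd 0 (suffix.map Particle.m)
  let avg ← parMap (fun s => Par.prim (.mean s.1 s.2)) (yCumsum.zip mCumsum)
  let a ← argmin avg
  Par.prim (.nadd i a)

/-- `t` rounds of binary search on `le, …, ri - 1` for the left end of the cluster that contains
the particles on both sides of the border `half` between the two halves of `P`. -/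
def searchLoop (P : List Particle) (half : ℕ) : ℕ → ℕ → ℕ → Par ℕ
  | 0, le, _ => .pure le
  | t + 1, le, ri => do
    let s ← Par.prim (.nadd le ri)
    let s' ← Par.prim (.nsub s 1)
    let mid ← Par.prim (.nhalf s')
    let j ← rightmostCollision P mid
    let left ← Par.prim (.nlt j half)
    let next ← Par.prim (.nadd mid 1)
    if left then searchLoop P half t next ri else searchLoop P half t le next

/-- Let the two solved halves of `P`, whose length `d` is a power of two, interact. -/
def mergeHalves (P : List Particle) : Par (List Particle) := do
  let d := P.length
  let le ← searchLoop P (d / 2) (Nat.log 2 d - 1) 0 (d / 2)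
  let j ← rightmostCollision P le
  let b ← Par.prim (.nlt le j)
  if b then performCollisions P le j else pure P

/-- The divide and conquer recursion on arrays of size `2 ^ k`. -/
def searchCollisionsPow : ℕ → List Particle → Par (List Particle)
  | 0, P => .pure P
  | k + 1, P =>
    .both (searchCollisionsPow k (P.take (2 ^ k))) (searchCollisionsPow k (P.drop (2 ^ k)))
      (fun L R => mergeHalves (L ++ R))

/-- The search collisions algorithm: pad with zeros to the next power of two (the sizes in the
recursion then are powers of two and need no more padding), then divide and conquer. -/
def searchCollisions (P : List Particle) : Par (List Particle) := do
  let k := Nat.clog 2 P.length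
  let zeros ← parMap (fun _ => do
    let x ← Par.prim (.rstore 0)
    let v ← Par.prim (.rstore 0)
    let m ← Par.prim (.nstore 0)
    pure (Particle.mk x v m)) (List.range (2 ^ k - P.length))
  searchCollisionsPow k (P ++ zeros)

/-- The input of the algorithm for a sorted weight vector `x`: the `i`-th of `d` particles (counted
from `1`) has position `x i`, velocity `(d - 2 * i + 1) / (d - 1)` and mass `1`. -/
def initialParticles {d : ℕ} (x : EuclideanSpace ℝ (Fin d)) : List Particle :=
  List.ofFn (fun i : Fin d =>
    Particle.mk (x i) (((d : ℝ) - 2 * ((i : ℕ) + 1 : ℝ) + 1) / ((d : ℝ) - 1)) 1)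

/-- The vector described by an array of particles: the destinations `x + v`, each repeated as often
as the mass says. -/
def finalPositions (P : List Particle) : List ℝ :=
  P.flatMap (fun q => List.replicate q.m (q.x + q.v))

end

/-!
For sorted `w` the regularizer is linear, `R(w) = -∑ vᵢ wᵢ`, where `v` are the initial velocities.
Sorting a competitor does not change `R` and, as `x` is sorted, does not increase the distance to
`x` (rearrangement inequality). So the proximal point is the projection `u` of `y = x + v` onto the
cone of sorted vectors, the isotonic regression of `y`; strong convexity makes it the only
minimizer. The projection is characterized by `⟪y - u, z⟫ ≤ 0` for all sorted `z` and
`⟪y - u, u⟫ = 0`. If `y` is cut into consecutive blocks whose averages are sorted and such that no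
prefix of a block has a smaller average than the block, then the vector of block averages has these
properties, by summation by parts on each block (`Solved.exists_projection`,
`isProx_of_projection`).

`Solved P Y` says that the array `P` holds such blocks for `Y`: masses are lengths of blocks,
destinations are averages. A single particle is solved, and `mergeHalves_solved` shows that merging
keeps the property. In a solved half the order of the averages is correct, so only the order across
the border can fail. The binary search needs no monotonicity: it ends at an index `a` such that the
cluster from `a - 1` does not reach across the border, and the cluster from `a` does or `a` is the
last index of the left half (`searchLoop_spec`). The cluster from `a` has the least average among
all segments that start at `a`. Hence it is a block, and it does not lie to the right of what
follows it; and since the cluster from `a - 1` stays in the left half, no particle up to `a - 1`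
lies to the right of the average of any segment that starts at `a`
(`IsArgminAvg.le_totalDest_drop`).

The costs follow the trees of the computations: maps take constant depth, reductions and scans of
at most `2 ^ k` elements take depth `O(k)`, all with linear work. Merging at size `2 ^ k` takes
`O(k)` of them, and the recursion sums this up to work `O(k² 2 ^ k)` and depth `O(k³)`. The time on
`p` processors follows from Brent's theorem `Par.exists_runsIn`: in each step of the greedy
schedule either all processors are busy or the depth decreases.
-/

namespace Par

/-! ### Sequential composition and Brent's theorem -/

section Basic

variable {α β : Type}

@[simp] theorem eval_pure (a : α) : (Pure.pure a : Par α).eval = a := rfl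
@[simp] theorem work_pure (a : α) : (Pure.pure a : Par α).work = 0 := rfl
@[simp] theorem depth_pure (a : α) : (Pure.pure a : Par α).depth = 0 := rfl
@[simp] theorem eval_prim (o : Prim α) : (prim o).eval = o.eval := rfl
@[simp] theorem work_prim (o : Prim α) : (prim o).work = 1 := rfl
@[simp] theorem depth_prim (o : Prim α) : (prim o).depth = 1 := rfl

@[simp] theorem eval_bind (c : Par α) (f : α → Par β) : (c >>= f).eval = (f c.eval).eval := by
  change (bind c f).eval = _
  induction c with
  | pure a => rfl
  | op o k ih => exact ih _ f
  | both c c' k _ _ ih => exact ih _ _ f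

@[simp] theorem work_bind (c : Par α) (f : α → Par β) :
    (c >>= f).work = c.work + (f c.eval).work := by
  change (bind c f).work = _
  induction c with
  | pure a => simp [bind, work, eval]
  | op o k ih =>
    simp only [bind, work, eval]
    rw [ih]; ring
  | both c c' k _ _ ih =>
    simp only [bind, work, eval]
    rw [ih]; ring

@[simp] theorem depth_bind (c : Par α) (f : α → Par β) :
    (c >>= f).depth = c.depth + (f c.eval).depth := by
  change (bind c f).depth = _
  induction c with
  | pure a => simp [bind, depth, eval]
  | op o k ih =>
    simp only [bind, depth, eval]
    rw [ih]; ring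
  | both c c' k _ _ ih =>
    simp only [bind, depth, eval]
    rw [ih]; ring

end Basic

/-- The computation has terminated. -/
def IsPure {α : Type} (c : Par α) : Prop := ∃ a, c = .pure a

/-- No join is waiting to be carried out: every join has an unfinished branch. -/
def Settled : {α : Type} → Par α → Prop
  | _, .pure _ => True
  | _, .op _ _ => True
  | _, .both c c' _ => Settled c ∧ Settled c' ∧ ¬ (IsPure c ∧ IsPure c')

theorem settle_spec {α : Type} (c : Par α) :
    Settled (settle c) ∧ (settle c).eval = c.eval ∧ (settle c).work = c.work ∧
      (settle c).depth = c.depth := by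
  induction c with
  | pure a => exact ⟨trivial, rfl, rfl, rfl⟩
  | op o k _ => exact ⟨trivial, rfl, rfl, rfl⟩
  | both c c' k ih ih' ihk =>
    obtain ⟨hs, he, hw, hd⟩ := ih
    obtain ⟨hs', he', hw', hd'⟩ := ih'
    by_cases hp : IsPure (settle c) ∧ IsPure (settle c')
    · obtain ⟨⟨b, hb⟩, b', hb'⟩ := hp
      have heq : settle (.both c c' k) = settle (k b b') := by
        simp [settle, hb, hb']
      rw [hb] at he hw hd
      rw [hb'] at he' hw' hd'
      simp only [eval, work, depth] at he hw hd he' hw' hd'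
      obtain ⟨h1, h2, h3, h4⟩ := ihk b b'
      rw [heq]
      refine ⟨h1, ?_, ?_, ?_⟩
      · rw [h2, eval, ← he, ← he']
      · rw [h3, work, ← he, ← he', ← hw, ← hw']; simp
      · rw [h4, depth, ← he, ← he', ← hd, ← hd']; simp
    · have heq : settle (.both c c' k) = .both (settle c) (settle c') k := by
        rw [settle]
        split
        · next b b' h h' => exact absurd ⟨⟨b, h⟩, ⟨b', h'⟩⟩ hp
        · rfl
      rw [heq]
      refine ⟨⟨hs, hs', hp⟩, ?_, ?_, ?_⟩
      · rw [eval, eval, he, he']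
      · rw [work, work, he, he', hw, hw']
      · rw [depth, depth, he, he', hd, hd']

theorem Settled.depth_pos {α : Type} {c : Par α} (h : Settled c) (hp : ¬ IsPure c) :
    1 ≤ c.depth := by
  induction c with
  | pure a => exact absurd ⟨a, rfl⟩ hp
  | op o k _ => simp [depth]
  | both c c' k ih ih' _ =>
    obtain ⟨h1, h2, h3⟩ := h
    rw [depth]
    by_cases hc : IsPure c
    · have := ih' h2 (fun h => h3 ⟨hc, h⟩)
      omega
    · have := ih h1 hc
      omega

/-- A step on `p` processors of which `q` stay idle performs `p - q` operations; if a processor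
stays idle, then all ready operations are performed, and the depth decreases. -/
theorem advance_spec {α : Type} (p : ℕ) (c : Par α) (h : Settled c) :
    (advance p c).2.eval = c.eval ∧ (advance p c).1 ≤ p ∧
      (advance p c).2.work + p = c.work + (advance p c).1 ∧
      (advance p c).2.depth ≤ c.depth ∧
      (0 < (advance p c).1 → (advance p c).2.depth ≤ c.depth - 1) := by
  induction c generalizing p with
  | pure a => cases p <;> simp [advance, depth]
  | op o k _ =>
    cases p with
    | zero => simp [advance]
    | succ p => simp [advance, eval, work, depth]; omega
  | both c c' k ih ih' _ =>
    obtain ⟨h1, h2, h3⟩ := h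
    obtain ⟨he, hq, hw, hd, hi⟩ := ih p h1
    obtain ⟨he', hq', hw', hd', hi'⟩ := ih' (advance p c).1 h2
    have hadv : advance p (.both c c' k) =
        ((advance (advance p c).1 c').1,
          .both (advance p c).2 (advance (advance p c).1 c').2 k) := by
      cases p <;> rfl
    have hpos : 1 ≤ max c.depth c'.depth := by
      by_cases hc : IsPure c
      · exact le_max_of_le_right (h2.depth_pos fun h => h3 ⟨hc, h⟩)
      · exact le_max_of_le_left (h1.depth_pos hc)
    rw [hadv]
    simp only [eval, work, depth, he, he']
    refine ⟨trivial, by omega, by omega, by omega, fun h => ?_⟩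
    have := hi' h
    have := hi (by omega)
    omega

/-- **Brent's theorem** for the greedy scheduler: a step either performs `p` operations or
decreases the depth. -/
theorem Settled.exists_tick_iterate {α : Type} {p : ℕ} (hp : 1 ≤ p) (c : Par α) (h : Settled c) :
    ∃ T : ℕ, (tick p)^[T] c = .pure c.eval ∧ p * T ≤ c.work + p * c.depth := by
  induction hn : c.work + c.depth using Nat.strong_induction_on generalizing c with
  | _ n ih =>
    by_cases hc : IsPure c
    · obtain ⟨a, rfl⟩ := hc
      exact ⟨0, rfl, by simp⟩
    · obtain ⟨he, hq, hw, hd, hi⟩ := advance_spec p c h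
      obtain ⟨hs, hse, hsw, hsd⟩ := settle_spec (advance p c).2
      have hpos := h.depth_pos hc
      obtain ⟨T, hT, hle⟩ := ih _ (by
        rw [hsw, hsd, ← hn]
        rcases Nat.eq_zero_or_pos (advance p c).1 with h0 | h0
        · omega
        · have := hi h0; omega) (settle (advance p c).2) hs rfl
      refine ⟨T + 1, ?_, ?_⟩
      · rw [Function.iterate_succ_apply, tick, hT, hse, he]
      · rw [hsw, hsd] at hle
        rw [Nat.mul_succ]
        rcases Nat.eq_zero_or_pos (advance p c).1 with h0 | h0
        · have := Nat.mul_le_mul_left p hd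
          omega
        · have h1 := Nat.mul_le_mul_left p (show (advance p c).2.depth + 1 ≤ c.depth by
            have := hi h0; omega)
          rw [Nat.mul_succ] at h1
          omega

theorem exists_runsIn {α : Type} {p : ℕ} (hp : 1 ≤ p) (c : Par α) :
    ∃ T : ℕ, RunsIn p c T c.eval ∧ (T : ℝ) ≤ c.work / p + c.depth := by
  obtain ⟨hs, he, hw, hd⟩ := settle_spec c
  obtain ⟨T, hT, hle⟩ := hs.exists_tick_iterate hp
  rw [he] at hT
  rw [hw, hd] at hle
  refine ⟨T, hT, ?_⟩
  have hp' : (0 : ℝ) < p := by exact_mod_cast hp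
  have hle' : (p : ℝ) * T ≤ c.work + p * c.depth := by exact_mod_cast hle
  rw [← mul_le_mul_iff_right₀ hp', mul_add, mul_div_cancel₀ _ hp'.ne']
  exact hle'

end Par

/-! ### Map, reduce and scan -/

section Primitives

variable {α β : Type}

theorem parMap_spec (f : α → Par β) {w δ : ℕ} (hw : ∀ a, (f a).work ≤ w)
    (hδ : ∀ a, (f a).depth ≤ δ) (l : List α) :
    (parMap f l).eval = l.map (fun a => (f a).eval) ∧ (parMap f l).work ≤ w * l.length ∧
      (parMap f l).depth ≤ δ := by
  induction l with
  | nil => exact ⟨rfl, Nat.zero_le _, Nat.zero_le _⟩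
  | cons a l ih =>
    obtain ⟨h1, h2, h3⟩ := ih
    have := hw a
    have := hδ a
    simp only [parMap, Par.eval, Par.work, Par.depth, h1, List.map_cons, List.length_cons,
      Nat.mul_succ, add_zero, true_and]
    omega

/-- Induction along the balanced binary tree of partial results; `k` bounds its height. -/
theorem upsweep_induction (f : α → α → Par α) (e : α) (Q : ℕ → List α → SumTree α → Prop)
    (leaf : ∀ k a, Q k [a] (.leaf a))
    (node : ∀ k l l' t u, Q k l t → Q k l' u →
      Q (k + 1) (l ++ l') (.node (f t.root u.root).eval t u))
    (k : ℕ) (l : List α) (hl : l ≠ []) (hk : l.length ≤ 2 ^ k) :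
    Q k l (upsweep f e l).eval := by
  induction k generalizing l with
  | zero =>
    obtain ⟨a, rfl⟩ : ∃ a, l = [a] := by
      rw [← List.length_eq_one_iff]
      have := List.length_pos_of_ne_nil hl
      simp at hk
      omega
    rw [upsweep]
    simpa [Par.eval] using leaf 0 a
  | succ k ih =>
    have hpos := List.length_pos_of_ne_nil hl
    rw [upsweep]
    split
    · next h =>
      obtain ⟨a, rfl⟩ : ∃ a, l = [a] := by
        rw [← List.length_eq_one_iff]
        omega
      simpa [Par.eval] using leaf (k + 1) a
    · next h =>
      rw [pow_succ] at hk
      have h1 := ih (l.take (l.length / 2))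
        (List.ne_nil_of_length_pos (by rw [List.length_take]; omega))
        (by rw [List.length_take]; omega)
      have h2 := ih (l.drop (l.length / 2))
        (List.ne_nil_of_length_pos (by rw [List.length_drop]; omega))
        (by rw [List.length_drop]; omega)
      have h3 := node k _ _ _ _ h1 h2
      rw [List.take_append_drop] at h3
      simpa [Par.eval] using h3

theorem upsweep_cost (f : α → α → Par α) (e : α) (hw : ∀ a b, (f a b).work ≤ 1)
    (hδ : ∀ a b, (f a b).depth ≤ 1) (k : ℕ) (l : List α) (hk : l.length ≤ 2 ^ k) :
    (upsweep f e l).work ≤ l.length - 1 ∧ (upsweep f e l).depth ≤ k := by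
  induction k generalizing l with
  | zero =>
    rw [upsweep, dif_pos (by simpa using hk)]
    simp [Par.work, Par.depth]
  | succ k ih =>
    rw [upsweep]
    split
    · simp [Par.work, Par.depth]
    · next h =>
      rw [pow_succ] at hk
      have h1 := ih (l.take (l.length / 2)) (by rw [List.length_take]; omega)
      have h2 := ih (l.drop (l.length / 2)) (by rw [List.length_drop]; omega)
      rw [List.length_take] at h1
      rw [List.length_drop] at h2
      simp only [Par.work, Par.depth, Par.work_bind, Par.depth_bind, Par.work_pure, Par.depth_pure]
      set a := ((upsweep f e (l.take (l.length / 2))).eval).root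
      set b := ((upsweep f e (l.drop (l.length / 2))).eval).root
      have := hw a b
      have := hδ a b
      omega

theorem reduce_induction (f : α → α → Par α) (e : α) (Q : List α → α → Prop)
    (single : ∀ a, Q [a] a)
    (append : ∀ l l' a b, Q l a → Q l' b → Q (l ++ l') (f a b).eval)
    (l : List α) (hl : l ≠ []) : Q l (reduce f e l).eval := by
  simpa [reduce] using upsweep_induction f e (fun _ l t => Q l t.root) (fun _ a => single a)
    (fun _ l l' t u h h' => append l l' _ _ h h') (Nat.clog 2 l.length) l hl
    (Nat.le_pow_clog (by norm_num) _)

theorem reduce_cost (f : α → α → Par α) (e : α) (hw : ∀ a b, (f a b).work ≤ 1)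
    (hδ : ∀ a b, (f a b).depth ≤ 1) (k : ℕ) (l : List α) (hk : l.length ≤ 2 ^ k) :
    (reduce f e l).work ≤ l.length ∧ (reduce f e l).depth ≤ k := by
  have := upsweep_cost f e hw hδ k l hk
  simp only [reduce, Par.work_bind, Par.depth_bind, Par.work_pure, Par.depth_pure]
  omega

theorem eval_reduce_sum [AddMonoid α] (f : α → α → Par α) (hf : ∀ a b, (f a b).eval = a + b)
    (l : List α) : (reduce f 0 l).eval = l.sum := by
  rcases eq_or_ne l [] with rfl | hl
  · simp [reduce, upsweep, Par.eval, SumTree.root]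
  · refine reduce_induction f 0 (fun l a => a = l.sum) (by simp) ?_ l hl
    rintro l l' _ _ rfl rfl
    simp [hf]

/-- The tree `t` of height at most `k` has the leaves `l`, and the nodes of `t` hold the sums of
the leaves below them. -/
inductive IsSumTree [AddMonoid α] : ℕ → List α → SumTree α → Prop
  | leaf (k : ℕ) (a : α) : IsSumTree k [a] (.leaf a)
  | node {k : ℕ} {l l' : List α} {t u : SumTree α} (ht : IsSumTree k l t)
      (hu : IsSumTree k l' u) : IsSumTree (k + 1) (l ++ l') (.node (l ++ l').sum t u)

theorem IsSumTree.root_eq [AddMonoid α] {k : ℕ} {l : List α} {t : SumTree α}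
    (h : IsSumTree k l t) : t.root = l.sum := by
  cases h <;> simp [SumTree.root]

/-- The list of all sums `acc + a₁ + ⋯ + aₖ`. -/
def prefixSums [AddMonoid α] : α → List α → List α
  | _, [] => []
  | acc, a :: l => (acc + a) :: prefixSums (acc + a) l

theorem prefixSums_append [AddMonoid α] (acc : α) (l l' : List α) :
    prefixSums acc (l ++ l') = prefixSums acc l ++ prefixSums (acc + l.sum) l' := by
  induction l generalizing acc with
  | nil => simp [prefixSums]
  | cons a l ih => simp [prefixSums, ih, add_assoc]

@[simp] theorem length_prefixSums [AddMonoid α] (acc : α) (l : List α) :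
    (prefixSums acc l).length = l.length := by
  induction l generalizing acc with
  | nil => rfl
  | cons a l ih => simp [prefixSums, ih]

theorem getElem_prefixSums [AddMonoid α] (acc : α) (l : List α) (n : ℕ)
    (h : n < (prefixSums acc l).length) :
    (prefixSums acc l)[n] = acc + (l.take (n + 1)).sum := by
  induction l generalizing acc n with
  | nil => simp [prefixSums] at h
  | cons a l ih =>
    cases n with
    | zero => simp [prefixSums]
    | succ n => simp [prefixSums, ih, add_assoc]

theorem IsSumTree.downsweep_spec [AddMonoid α] {f : α → α → Par α}
    (hf : ∀ a b, (f a b).eval = a + b) (hw : ∀ a b, (f a b).work ≤ 1)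
    (hδ : ∀ a b, (f a b).depth ≤ 1) {k : ℕ} {l : List α} {t : SumTree α} (h : IsSumTree k l t)
    (acc : α) :
    (downsweep f acc t).eval = prefixSums acc l ∧ (downsweep f acc t).work + 1 ≤ 2 * l.length ∧
      (downsweep f acc t).depth ≤ k + 1 := by
  induction h generalizing acc with
  | leaf k a =>
    have := hw acc a
    have := hδ acc a
    simp only [downsweep, Par.eval_bind, Par.eval_pure, Par.work_bind, Par.work_pure,
      Par.depth_bind, Par.depth_pure, prefixSums, hf, List.length_singleton, true_and]
    omega
  | node ht hu iht ihu =>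
    rename_i k l l' t u
    obtain ⟨h1, h2, h3⟩ := iht acc
    obtain ⟨h4, h5, h6⟩ := ihu (acc + l.sum)
    have := hw acc l.sum
    have := hδ acc l.sum
    simp only [downsweep, Par.eval_bind, Par.work_bind, Par.depth_bind, ht.root_eq, hf, Par.eval,
      Par.work, Par.depth, h1, h4, prefixSums_append, List.length_append, true_and]
    omega

theorem scan_spec [AddMonoid α] {f : α → α → Par α}
    (hf : ∀ a b, (f a b).eval = a + b) (hw : ∀ a b, (f a b).work ≤ 1)
    (hδ : ∀ a b, (f a b).depth ≤ 1) (k : ℕ) (l : List α) (hl : l ≠ []) (hk : l.length ≤ 2 ^ k) :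
    (scan f 0 l).eval = prefixSums 0 l ∧ (scan f 0 l).work ≤ 3 * l.length ∧
      (scan f 0 l).depth ≤ 2 * k + 1 := by
  have ht : IsSumTree k l (upsweep f 0 l).eval := by
    refine upsweep_induction f 0 IsSumTree .leaf ?_ k l hl hk
    intro k l l' t u h h'
    rw [hf, h.root_eq, h'.root_eq, ← List.sum_append]
    exact .node h h'
  obtain ⟨h1, h2, h3⟩ := ht.downsweep_spec hf hw hδ 0
  have := upsweep_cost f 0 hw hδ k l hk
  simp only [scan, Par.eval_bind, Par.work_bind, Par.depth_bind, h1, true_and]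
  omega

end Primitives

theorem argmin_cost (k : ℕ) (l : List (WithTop ℝ)) (hk : l.length ≤ 2 ^ k) :
    (argmin l).work ≤ l.length ∧ (argmin l).depth ≤ k := by
  have := reduce_cost
    (fun (a b : WithTop ℝ × ℕ) => do
      let c ← Par.prim (.lt b.1 a.1)
      pure (if c then b else a)) (⊤, 0) (by simp) (by simp) k l.zipIdx (by simpa using hk)
  simpa [argmin] using this

theorem argmin_spec (l : List (WithTop ℝ)) (hl : l ≠ []) :
    ∃ (a : ℕ) (h : a < l.length), (argmin l).eval = a ∧
      ∀ (k : ℕ) (hk : k < l.length), l[a] ≤ l[k] := by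
  obtain ⟨hmem, hle⟩ := reduce_induction
    (fun (a b : WithTop ℝ × ℕ) => do
      let c ← Par.prim (.lt b.1 a.1)
      pure (if c then b else a)) (⊤, 0)
    (fun L r => r ∈ L ∧ ∀ q ∈ L, r.1 ≤ q.1)
    (by simp)
    (by
      rintro L L' a b ⟨ha, hla⟩ ⟨hb, hlb⟩
      simp only [Par.eval_bind, Par.eval_prim, Prim.eval, Par.eval_pure, decide_eq_true_eq]
      split
      · next h =>
        refine ⟨by simp [hb], fun q hq => ?_⟩
        rcases List.mem_append.1 hq with hq | hq
        · exact h.le.trans (hla q hq)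
        · exact hlb q hq
      · next h =>
        refine ⟨by simp [ha], fun q hq => ?_⟩
        rcases List.mem_append.1 hq with hq | hq
        · exact hla q hq
        · exact (not_lt.1 h).trans (hlb q hq))
    l.zipIdx (by simpa using hl)
  obtain ⟨hr, hr'⟩ := List.mem_zipIdx' hmem
  refine ⟨_, hr, by simp [argmin], fun k hk => ?_⟩
  rw [← hr']
  exact hle (l[k], k) (by simp [List.mem_zipIdx_iff_getElem?, hk])

/-! ### The subroutines: results, work and depth -/

section Subroutines

/-- The destination `x + v` of a particle. -/
noncomputable def Particle.dest (q : Particle) : ℝ := q.x + q.v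

/-- The total mass of an array of particles. -/
def totalMass (P : List Particle) : ℕ := (P.map Particle.m).sum

/-- The sum of the destinations, weighted by mass. -/
noncomputable def totalDest (P : List Particle) : ℝ := (P.map (fun q => q.dest * (q.m : ℝ))).sum

/-- The average destination by mass; it is `⊤` if the total mass is zero. -/
noncomputable def avgDest (P : List Particle) : WithTop ℝ :=
  if totalMass P = 0 then ⊤ else ((totalDest P / (totalMass P : ℝ) : ℝ) : WithTop ℝ)

theorem realAdd_cost (a b : ℝ) : (realAdd a b).work ≤ 1 ∧ (realAdd a b).depth ≤ 1 := by
  simp [realAdd]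

theorem natAdd_cost (a b : ℕ) : (natAdd a b).work ≤ 1 ∧ (natAdd a b).depth ≤ 1 := by
  simp [natAdd]

/-- Among the nonempty prefixes of `Q`, the one of length `a + 1` has the least average. -/
def IsArgminAvg (Q : List Particle) (a : ℕ) : Prop :=
  a < Q.length ∧ ∀ n < Q.length, avgDest (Q.take (a + 1)) ≤ avgDest (Q.take (n + 1))

theorem rightmostCollision_spec (P : List Particle) (i k : ℕ) (hi : i < P.length)
    (hk : P.length ≤ 2 ^ k) :
    (∃ a, (rightmostCollision P i).eval = i + a ∧ IsArgminAvg (P.drop i) a) ∧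
    (rightmostCollision P i).work ≤ 12 * 2 ^ k ∧ (rightmostCollision P i).depth ≤ 5 * k + 7 := by
  set Q := P.drop i with hQ
  have hQk : Q.length ≤ 2 ^ k := by
    rw [hQ, List.length_drop]; omega
  have hQ0 : Q ≠ [] := List.ne_nil_of_length_pos (by rw [hQ, List.length_drop]; omega)
  obtain ⟨y1, y2, y3⟩ := parMap_spec (fun q : Particle => do
    let y ← Par.prim (.radd q.x q.v)
    let c ← Par.prim (.cast q.m)
    Par.prim (.rmul y c)) (w := 3) (δ := 3) (by simp) (by simp) Q
  simp only [Par.eval_bind, Par.eval_prim, Prim.eval] at y1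
  have hval := y1
  set ym := (parMap (fun q : Particle => do
    let y ← Par.prim (.radd q.x q.v)
    let c ← Par.prim (.cast q.m)
    Par.prim (.rmul y c)) Q).eval with hym
  have hyl : ym.length = Q.length := by rw [y1, List.length_map]
  obtain ⟨s1, s2, s3⟩ := scan_spec (f := realAdd) (fun _ _ => rfl) (fun a b => (realAdd_cost a b).1)
    (fun a b => (realAdd_cost a b).2) k ym (by rw [← List.length_pos_iff] at hQ0 ⊢; omega)
    (by omega)
  obtain ⟨t1, t2, t3⟩ := scan_spec (f := natAdd) (fun _ _ => rfl) (fun a b => (natAdd_cost a b).1)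
    (fun a b => (natAdd_cost a b).2) k (Q.map Particle.m) (by simpa using hQ0)
    (by simpa using hQk)
  rw [List.length_map] at t2
  obtain ⟨a1, a2, a3⟩ := parMap_spec (fun s : ℝ × ℕ => Par.prim (.mean s.1 s.2)) (w := 1) (δ := 1)
    (by simp) (by simp)
    ((prefixSums 0 ym).zip (prefixSums 0 (Q.map Particle.m)))
  set avg := (parMap (fun s : ℝ × ℕ => Par.prim (.mean s.1 s.2))
    ((prefixSums 0 ym).zip (prefixSums 0 (Q.map Particle.m)))).eval with havg
  have hal : avg.length = Q.length := by
    rw [a1]; simp [hyl]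
  have hag : ∀ (n : ℕ) (h : n < avg.length), avg[n] = avgDest (Q.take (n + 1)) := by
    intro n h
    simp only [a1, List.getElem_map, List.getElem_zip, getElem_prefixSums, zero_add,
      Par.eval_prim, Prim.eval, avgDest, totalMass, totalDest, hval, List.map_take, Particle.dest]
  obtain ⟨a, ha, hae, hmin⟩ := argmin_spec avg (by
    rw [← List.length_pos_iff] at hQ0 ⊢; omega)
  obtain ⟨m1, m2⟩ := argmin_cost k avg (by omega)
  have hz : ((prefixSums 0 ym).zip (prefixSums 0 (Q.map Particle.m))).length = Q.length := by
    simp [hyl]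
  refine ⟨⟨a, ?_, by omega, ?_⟩, ?_, ?_⟩
  · simp only [rightmostCollision, Par.eval_bind, Par.eval_prim, ← hQ, ← hym, s1, t1, ← havg, hae,
      Prim.eval]
  · intro n hn
    rw [← hag a ha, ← hag n (by omega)]
    exact hmin n (by omega)
  · simp only [rightmostCollision, Par.work_bind, Par.work_prim, ← hQ, ← hym, s1, t1, ← havg]
    have := Nat.one_le_two_pow (n := k)
    omega
  · simp only [rightmostCollision, Par.depth_bind, Par.depth_prim, ← hQ, ← hym, s1, t1, ← havg]
    omega

/-- The particle that results from a collision of the particles `S`. -/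
noncomputable def mergedParticle (S : List Particle) : Particle where
  x := (S.map (fun q => q.x * (q.m : ℝ))).sum / totalMass S
  v := (S.map (fun q => q.v * (q.m : ℝ))).sum / totalMass S
  m := totalMass S

theorem performCollisions_spec (P : List Particle) (i j k : ℕ) (hk : P.length ≤ 2 ^ k) :
    (performCollisions P i j).eval =
      P.take i ++ mergedParticle ((P.drop i).take (j + 1 - i)) ::
        ((P.drop i).take (j + 1 - i)).tail.map (fun q => Particle.mk q.x q.v 0) ++
        P.drop (j + 1) ∧
    (performCollisions P i j).work ≤ 11 * 2 ^ k ∧ (performCollisions P i j).depth ≤ 3 * k + 9 := by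
  set S := (P.drop i).take (j + 1 - i) with hS
  have hSk : S.length ≤ 2 ^ k := by
    rw [hS, List.length_take, List.length_drop]; omega
  obtain ⟨x1, x2, x3⟩ := parMap_spec (fun q : Particle => do
    let c ← Par.prim (.cast q.m)
    Par.prim (.rmul q.x c)) (w := 2) (δ := 2) (by simp) (by simp) S
  obtain ⟨v1, v2, v3⟩ := parMap_spec (fun q : Particle => do
    let c ← Par.prim (.cast q.m)
    Par.prim (.rmul q.v c)) (w := 2) (δ := 2) (by simp) (by simp) S
  obtain ⟨z1, z2, z3⟩ := parMap_spec (fun q : Particle => do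
    let z ← Par.prim (.nstore 0)
    Pure.pure (Particle.mk q.x q.v z)) (w := 1) (δ := 1) (by simp) (by simp) S.tail
  simp only [Par.eval_bind, Par.eval_prim, Prim.eval, Par.eval_pure] at x1 v1 z1
  have hr : ∀ l : List ℝ, (reduce realAdd 0 l).eval = l.sum :=
    eval_reduce_sum realAdd (fun _ _ => rfl)
  have hn : ∀ l : List ℕ, (reduce natAdd 0 l).eval = l.sum :=
    eval_reduce_sum natAdd (fun _ _ => rfl)
  have hrc := reduce_cost realAdd 0 (fun a b => (realAdd_cost a b).1)
    (fun a b => (realAdd_cost a b).2) k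
  obtain ⟨c1, c2⟩ := reduce_cost natAdd 0 (fun a b => (natAdd_cost a b).1)
    (fun a b => (natAdd_cost a b).2) k (S.map Particle.m) (by simpa using hSk)
  obtain ⟨c3, c4⟩ := hrc (S.map fun q => q.x * (q.m : ℝ)) (by simpa using hSk)
  obtain ⟨c5, c6⟩ := hrc (S.map fun q => q.v * (q.m : ℝ)) (by simpa using hSk)
  rw [List.length_map] at c1 c3 c5
  rw [List.length_tail] at z2
  refine ⟨?_, ?_, ?_⟩
  · simp only [performCollisions, Par.eval_bind, Par.eval_prim, ← hS, x1, v1, z1, hr, hn,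
      Prim.eval, Par.eval_pure, mergedParticle, totalMass]
  · simp only [performCollisions, Par.work_bind, Par.work_prim, ← hS, x1, v1, hr,
      hn, Par.work_pure]
    have := Nat.one_le_two_pow (n := k)
    omega
  · simp only [performCollisions, Par.depth_bind, Par.depth_prim, ← hS, x1, v1, hr,
      hn, Par.depth_pure]
    omega

/-- The loop finds an index `a` below the border such that the cluster that starts at `a - 1` does
not reach across the border, but the cluster that starts at `a` does, or `a` is the last index
below the border. -/
theorem searchLoop_spec (P : List Particle) (half k : ℕ) (hP : half ≤ P.length)
    (hk : P.length ≤ 2 ^ k) (t le ri : ℕ) (ht : ri = le + 2 ^ t) (hri : ri ≤ half)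
    (h1 : le = 0 ∨ (rightmostCollision P (le - 1)).eval < half)
    (h2 : ri = half ∨ half ≤ (rightmostCollision P (ri - 1)).eval) :
    (∃ a, (searchLoop P half t le ri).eval = a ∧ a < half ∧
      (a = 0 ∨ (rightmostCollision P (a - 1)).eval < half) ∧
      (a + 1 = half ∨ half ≤ (rightmostCollision P a).eval)) ∧
    (searchLoop P half t le ri).work ≤ t * (17 * 2 ^ k) ∧
    (searchLoop P half t le ri).depth ≤ t * (5 * k + 12) := by
  induction t generalizing le ri with
  | zero =>
    subst ht
    refine ⟨⟨le, rfl, by omega, h1, by simpa using h2⟩, ?_, ?_⟩ <;>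
      simp [searchLoop, Par.work, Par.depth]
  | succ t ih =>
    obtain ⟨mid, hmid⟩ : ∃ mid, mid = (le + ri - 1) / 2 := ⟨_, rfl⟩
    have hpow := Nat.one_le_two_pow (n := t)
    have hpk := Nat.one_le_two_pow (n := k)
    rw [pow_succ] at ht
    have hmid' : mid + 1 = le + 2 ^ t := by omega
    obtain ⟨-, r1, r2⟩ := rightmostCollision_spec P mid k (by omega) hk
    by_cases hj : (rightmostCollision P mid).eval < half
    · obtain ⟨e1, e2, e3⟩ := ih (mid + 1) ri (by omega) hri (Or.inr (by simpa using hj)) h2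
      simp only [searchLoop, Par.eval_bind, Par.eval_prim, Par.work_bind, Par.work_prim,
        Par.depth_bind, Par.depth_prim, Prim.eval, ← hmid, hj, decide_true, if_true]
      refine ⟨e1, ?_, ?_⟩
      · rw [Nat.succ_mul]; omega
      · rw [Nat.succ_mul]; omega
    · obtain ⟨e1, e2, e3⟩ := ih le (mid + 1) hmid' (by omega) h1
        (Or.inr (by simpa using hj))
      simp only [searchLoop, Par.eval_bind, Par.eval_prim, Par.work_bind, Par.work_prim,
        Par.depth_bind, Par.depth_prim, Prim.eval, ← hmid, hj, decide_false, Bool.false_eq_true,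
        if_false]
      refine ⟨e1, ?_, ?_⟩
      · rw [Nat.succ_mul]; omega
      · rw [Nat.succ_mul]; omega

/-- The `k` rounds of the search and the last collision take `k + 1` rounds of cost proportional to
the size `2 ^ (k + 1)`. The search guarantees that the cluster from `a` reaches the border: `j` is
at least the last index of the left half. -/
theorem mergeHalves_spec (P : List Particle) (k : ℕ) (hP : P.length = 2 ^ (k + 1)) :
    (∃ a j, a < 2 ^ k ∧ 2 ^ k ≤ j + 1 ∧ a ≤ j ∧ j < P.length ∧
      (rightmostCollision P a).eval = j ∧
      (a = 0 ∨ (rightmostCollision P (a - 1)).eval < 2 ^ k) ∧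
      (mergeHalves P).eval = if a < j then (performCollisions P a j).eval else P) ∧
    (mergeHalves P).work ≤ 24 * (k + 1) * 2 ^ (k + 1) ∧
    (mergeHalves P).depth ≤ 33 * (k + 1) ^ 2 := by
  have hlog : Nat.log 2 (2 ^ (k + 1)) - 1 = k := by
    rw [Nat.log_pow (by norm_num)]; rfl
  have hhalf : 2 ^ (k + 1) / 2 = 2 ^ k := by rw [pow_succ]; simp
  have hpk := Nat.one_le_two_pow (n := k)
  obtain ⟨⟨a, ha, hah, h1, h2⟩, s2, s3⟩ := searchLoop_spec P (2 ^ k) (k + 1)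
    (by rw [hP, pow_succ]; omega) hP.le k 0 (2 ^ k) (by simp) le_rfl (Or.inl rfl) (Or.inl rfl)
  obtain ⟨⟨b, hbe, hb, -⟩, r2, r3⟩ := rightmostCollision_spec P a (k + 1)
    (by rw [hP, pow_succ]; omega) hP.le
  rw [List.length_drop] at hb
  obtain ⟨-, p2, p3⟩ := performCollisions_spec P a (a + b) (k + 1) hP.le
  rw [hbe] at h2
  refine ⟨⟨a, a + b, hah, by omega, by omega, by omega, hbe, h1, ?_⟩, ?_, ?_⟩
  · simp only [mergeHalves, Par.eval_bind, hP, hlog, hhalf, ha, hbe, Par.eval_prim, Prim.eval,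
      decide_eq_true_eq]
    split <;> rfl
  · simp only [mergeHalves, Par.work_bind, hP, hlog, hhalf, ha, hbe, Par.work_prim,
      Par.eval_prim, Prim.eval, decide_eq_true_eq]
    have hw : (if a < a + b then performCollisions P a (a + b) else Pure.pure P).work ≤
        11 * 2 ^ (k + 1) := by
      split
      · exact p2
      · simp
    have : 1 ≤ 2 ^ (k + 1) := Nat.one_le_two_pow
    nlinarith
  · simp only [mergeHalves, Par.depth_bind, hP, hlog, hhalf, ha, hbe, Par.depth_prim,
      Par.eval_prim, Prim.eval, decide_eq_true_eq]
    have hw : (if a < a + b then performCollisions P a (a + b) else Pure.pure P).depth ≤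
        3 * (k + 1) + 9 := by
      split
      · exact p3
      · simp
    nlinarith

end Subroutines

/-! ### Merging two solved halves -/

section Merging

/-- Particles of positive mass are ordered by their destinations; particles of mass zero stand for
empty slots and are not constrained. -/
def Particle.Le (p q : Particle) : Prop := p.m ≠ 0 → q.m ≠ 0 → p.dest ≤ q.dest

/-- The particle `p` stands for the block `b` of destinations: its mass is the length of `b`, its
destination is the average of `b`, and no prefix of `b` has a smaller average. -/
structure IsBlock (p : Particle) (b : List ℝ) : Prop where
  length_eq : b.length = p.m
  sum_eq : b.sum = p.dest * p.m
  le_sum_take : ∀ t ≤ p.m, p.dest * t ≤ (b.take t).sum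

/-- The array `P` describes the isotonic regression of `Y`: cutting `Y` into blocks according to
the masses in `P`, the destinations are the averages of the blocks, they are sorted, and no prefix
of a block has a smaller average than the block. -/
def Solved (P : List Particle) (Y : List ℝ) : Prop :=
  (∃ B : List (List ℝ), List.Forall₂ IsBlock P B ∧ B.flatten = Y) ∧ P.Pairwise Particle.Le

@[simp] theorem totalMass_nil : totalMass [] = 0 := rfl
@[simp] theorem totalDest_nil : totalDest [] = 0 := rfl
@[simp] theorem totalMass_cons (p : Particle) (P : List Particle) :
    totalMass (p :: P) = p.m + totalMass P := by simp [totalMass]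
@[simp] theorem totalDest_cons (p : Particle) (P : List Particle) :
    totalDest (p :: P) = p.dest * p.m + totalDest P := by simp [totalDest]
@[simp] theorem totalMass_append (P Q : List Particle) :
    totalMass (P ++ Q) = totalMass P + totalMass Q := by simp [totalMass]
@[simp] theorem totalDest_append (P Q : List Particle) :
    totalDest (P ++ Q) = totalDest P + totalDest Q := by simp [totalDest]

theorem totalMass_eq_zero {P : List Particle} : totalMass P = 0 ↔ ∀ q ∈ P, q.m = 0 := by
  simp [totalMass, List.sum_eq_zero_iff]

theorem totalDest_eq_zero {P : List Particle} (h : totalMass P = 0) : totalDest P = 0 := by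
  rw [totalMass_eq_zero] at h
  refine List.sum_eq_zero fun x hx => ?_
  obtain ⟨q, hq, rfl⟩ := List.mem_map.1 hx
  simp [h q hq]

theorem totalDest_le {c : ℝ} {P : List Particle} (h : ∀ q ∈ P, q.m ≠ 0 → q.dest ≤ c) :
    totalDest P ≤ c * totalMass P := by
  induction P with
  | nil => simp
  | cons p P ih =>
    have h1 := ih fun q hq => h q (List.mem_cons_of_mem _ hq)
    have h2 : p.dest * p.m ≤ c * p.m := by
      by_cases hp : p.m = 0
      · simp [hp]
      · exact mul_le_mul_of_nonneg_right (h p List.mem_cons_self hp) (Nat.cast_nonneg _)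
    rw [totalDest_cons, totalMass_cons]
    push_cast
    linarith

theorem le_totalDest {c : ℝ} {P : List Particle} (h : ∀ q ∈ P, q.m ≠ 0 → c ≤ q.dest) :
    c * totalMass P ≤ totalDest P := by
  induction P with
  | nil => simp
  | cons p P ih =>
    have h1 := ih fun q hq => h q (List.mem_cons_of_mem _ hq)
    have h2 : c * p.m ≤ p.dest * p.m := by
      by_cases hp : p.m = 0
      · simp [hp]
      · exact mul_le_mul_of_nonneg_right (h p List.mem_cons_self hp) (Nat.cast_nonneg _)
    rw [totalDest_cons, totalMass_cons]
    push_cast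
    linarith

/-- For total mass zero, both sides vanish, whatever the value of the division by zero. -/
theorem mergedParticle_dest_mul (S : List Particle) :
    (mergedParticle S).dest * totalMass S = totalDest S := by
  have h : (S.map (fun q => q.x * (q.m : ℝ))).sum + (S.map (fun q => q.v * (q.m : ℝ))).sum =
      totalDest S := by
    rw [← List.sum_map_add]
    simp only [totalDest, Particle.dest, add_mul]
  by_cases h0 : totalMass S = 0
  · rw [totalDest_eq_zero h0, h0]; simp
  · have h0' : (totalMass S : ℝ) ≠ 0 := by exact_mod_cast h0
    rw [← h, Particle.dest, mergedParticle]
    field_simp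

theorem length_flatten_of_isBlock {S : List Particle} {B : List (List ℝ)}
    (h : List.Forall₂ IsBlock S B) : B.flatten.length = totalMass S := by
  induction h with
  | nil => rfl
  | cons hb _ ih => simp [← ih, hb.length_eq]

theorem sum_flatten_of_isBlock {S : List Particle} {B : List (List ℝ)}
    (h : List.Forall₂ IsBlock S B) : B.flatten.sum = totalDest S := by
  induction h with
  | nil => rfl
  | cons hb _ ih => simp [← ih, hb.sum_eq]

/-- A linear lower bound for the partial sums at the ends of the blocks holds between them too. -/
theorem le_sum_take_flatten_of_isBlock {S : List Particle} {B : List (List ℝ)}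
    (h : List.Forall₂ IsBlock S B) (c acc : ℝ)
    (hc : ∀ n ≤ S.length, c * totalMass (S.take n) ≤ acc + totalDest (S.take n))
    (t : ℕ) (ht : t ≤ totalMass S) : c * t ≤ acc + (B.flatten.take t).sum := by
  induction h generalizing acc t with
  | nil =>
    have := hc 0 le_rfl
    simp at this ht
    simpa [ht] using this
  | cons hb _ ih =>
    rename_i p b S B _
    have h0 : 0 ≤ acc := by simpa using hc 0 (Nat.zero_le _)
    have h1 : c * p.m ≤ acc + p.dest * p.m := by simpa using hc 1 (by simp)
    rw [List.flatten_cons, List.take_append]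
    rcases le_total t p.m with hle | hle
    · have h2 := hb.le_sum_take t hle
      have h3 : t - b.length = 0 := by rw [hb.length_eq]; omega
      have hle' : (t : ℝ) ≤ p.m := by exact_mod_cast hle
      have ht0 : (0 : ℝ) ≤ t := Nat.cast_nonneg _
      rw [h3]
      simp only [List.take_zero, List.append_nil]
      -- the bound is affine in `t` on the block, and it holds at both ends
      rcases le_total c p.dest with hcp | hcp
      · nlinarith
      · nlinarith
    · obtain ⟨s, rfl⟩ := Nat.exists_eq_add_of_le hle
      have h2 := ih (acc + p.dest * p.m - c * p.m) (fun n hn => by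
        have := hc (n + 1) (by simpa using hn)
        simp only [List.take_succ_cons, totalMass_cons, totalDest_cons] at this
        push_cast at this
        linarith) s (by rw [totalMass_cons] at ht; omega)
      rw [List.take_of_length_le (by rw [hb.length_eq]; omega), hb.length_eq, List.sum_append,
        hb.sum_eq, Nat.add_sub_cancel_left]
      push_cast
      linarith

/-- A collision of consecutive particles yields a block if no prefix of the colliding particles has
a smaller average. -/
theorem isBlock_mergedParticle {S : List Particle} {B : List (List ℝ)}
    (h : List.Forall₂ IsBlock S B)
    (hS : ∀ n ≤ S.length,
      (mergedParticle S).dest * totalMass (S.take n) ≤ totalDest (S.take n)) :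
    IsBlock (mergedParticle S) B.flatten where
  length_eq := length_flatten_of_isBlock h
  sum_eq := by rw [sum_flatten_of_isBlock h, ← mergedParticle_dest_mul]; rfl
  le_sum_take t ht := by
    simpa using le_sum_take_flatten_of_isBlock h (mergedParticle S).dest 0 (by simpa using hS) t ht

/-- If the least average is `⊤`, then there is no mass at all. -/
theorem IsArgminAvg.totalMass_eq_zero {Q : List Particle} {a : ℕ} (h : IsArgminAvg Q a)
    (h0 : totalMass (Q.take (a + 1)) = 0) : totalMass Q = 0 := by
  by_contra hne
  have hpos := h.1
  have h1 := h.2 (Q.length - 1) (by omega)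
  rw [Nat.sub_add_cancel (by omega), List.take_length, avgDest, avgDest, if_pos h0, if_neg hne] at h1
  exact WithTop.coe_ne_top (top_le_iff.1 h1)

/-- The least average is a lower bound for all averages, in a form without division that also
holds for total mass zero. -/
theorem IsArgminAvg.le_totalDest {Q : List Particle} {a : ℕ} (h : IsArgminAvg Q a) (n : ℕ) :
    (mergedParticle (Q.take (a + 1))).dest * totalMass (Q.take n) ≤ totalDest (Q.take n) := by
  by_cases hn : totalMass (Q.take n) = 0
  · rw [totalDest_eq_zero hn, hn]; simp
  by_cases h0 : totalMass (Q.take (a + 1)) = 0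
  · have h1 := h.totalMass_eq_zero h0
    rw [← List.take_append_drop n Q, totalMass_append] at h1
    omega
  obtain ⟨n', hn', heq⟩ : ∃ n' < Q.length, Q.take n = Q.take (n' + 1) := by
    have hpos : n ≠ 0 := by rintro rfl; simp at hn
    have := h.1
    rcases le_total n Q.length with hle | hle
    · exact ⟨n - 1, by omega, by rw [Nat.sub_add_cancel (by omega)]⟩
    · exact ⟨Q.length - 1, by omega,
        by rw [List.take_of_length_le hle, List.take_of_length_le (by omega)]⟩
  have h1 := h.2 n' hn'
  rw [← heq, avgDest, avgDest, if_neg h0, if_neg hn, WithTop.coe_le_coe] at h1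
  have hm : (0 : ℝ) < totalMass (Q.take n) := by exact_mod_cast Nat.pos_of_ne_zero hn
  have hm' : (totalMass (Q.take (a + 1)) : ℝ) ≠ 0 := by exact_mod_cast h0
  rwa [le_div_iff₀ hm, ← mergedParticle_dest_mul (Q.take (a + 1)), mul_div_cancel_right₀ _ hm']
    at h1

/-- A merged particle does not lie to the right of the particles after it. -/
theorem IsArgminAvg.mergedParticle_le {Q : List Particle} {a : ℕ} (h : IsArgminAvg Q a)
    (hD : (Q.drop (a + 1)).Pairwise Particle.Le) :
    ∀ q ∈ Q.drop (a + 1), (mergedParticle (Q.take (a + 1))).Le q := by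
  intro q hq _ hqm
  obtain ⟨D₁, D₂, hDeq⟩ := List.append_of_mem hq
  have h1 := h.le_totalDest (a + 1 + (D₁.length + 1))
  have h2 : (Q.drop (a + 1)).take (D₁.length + 1) = D₁ ++ [q] := by
    rw [hDeq, List.take_append]; simp
  have h5 : Q.take (a + 1 + (D₁.length + 1)) = Q.take (a + 1) ++ (D₁ ++ [q]) := by
    rw [List.take_add (i := a + 1) (j := D₁.length + 1), h2]
  rw [h5, totalMass_append, totalDest_append, ← mergedParticle_dest_mul (Q.take (a + 1))] at h1
  have h3 : totalDest (D₁ ++ [q]) ≤ q.dest * totalMass (D₁ ++ [q]) := by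
    refine totalDest_le fun r hr hrm => ?_
    rw [List.mem_append, List.mem_singleton] at hr
    rcases hr with hr | rfl
    · rw [hDeq, List.pairwise_append] at hD
      exact hD.2.2 r hr q List.mem_cons_self hrm hqm
    · exact le_rfl
  have h4 : (0 : ℝ) < totalMass (D₁ ++ [q]) := by
    rw [totalMass_append, totalMass_cons]
    have := Nat.pos_of_ne_zero hqm
    exact_mod_cast (by omega)
  push_cast at h1
  exact le_of_mul_le_mul_right (by linarith) h4

/-- If the cluster that starts at `i` stays within a sorted part of the array, then a particle up
to `i` does not lie to the right of the average of any segment that starts at `i + 1`. -/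
theorem IsArgminAvg.le_totalDest_drop {P : List Particle} {i a : ℕ}
    (h : IsArgminAvg (P.drop i) a) (hA : (P.take (i + (a + 1))).Pairwise Particle.Le) :
    ∀ p ∈ P.take (i + 1), p.m ≠ 0 → ∀ n,
      p.dest * totalMass ((P.drop (i + 1)).take n) ≤ totalDest ((P.drop (i + 1)).take n) := by
  have hi : i < P.length := by
    have := h.1; rw [List.length_drop] at this; omega
  rw [List.take_add, List.pairwise_append] at hA
  set S := (P.drop i).take (a + 1) with hS
  have hcons : P.drop i = P[i] :: P.drop (i + 1) := List.drop_eq_getElem_cons hi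
  set r := P[i] with hr
  have key : ∀ c : ℝ, (∀ q ∈ S, q.m ≠ 0 → c ≤ q.dest) → ∀ n,
      c * ((r.m : ℝ) + totalMass ((P.drop (i + 1)).take n)) ≤
        r.dest * r.m + totalDest ((P.drop (i + 1)).take n) := by
    intro c hc n
    have h1 := h.le_totalDest (n + 1)
    rw [← hS] at h1
    have h2 : (P.drop i).take (n + 1) = r :: (P.drop (i + 1)).take n := by
      rw [hcons, List.take_succ_cons]
    rw [h2, totalMass_cons, totalDest_cons] at h1
    push_cast at h1
    -- without mass in the cluster there is none behind it either, and both sides vanish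
    by_cases h0 : totalMass S = 0
    · have h3 := h.totalMass_eq_zero h0
      rw [← List.take_append_drop (n + 1) (P.drop i), totalMass_append, h2, totalMass_cons] at h3
      have h4 : r.m = 0 := by omega
      have h5 : totalMass ((P.drop (i + 1)).take n) = 0 := by omega
      rw [totalDest_eq_zero h5, h5, h4]; simp
    · have h3 : (0 : ℝ) < totalMass S := by exact_mod_cast Nat.pos_of_ne_zero h0
      have h4 : c ≤ (mergedParticle S).dest := by
        refine le_of_mul_le_mul_right ?_ h3
        rw [mergedParticle_dest_mul]
        exact _root_.le_totalDest hc
      refine le_trans (mul_le_mul_of_nonneg_right h4 ?_) h1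
      positivity
  have hrS : S = r :: (P.drop (i + 1)).take a := by rw [hS, hcons, List.take_succ_cons]
  intro p hp hpm n
  have hp' : p ∈ P.take i ∨ p = r := by
    rw [List.take_succ_eq_append_getElem hi, List.mem_append, List.mem_singleton] at hp
    exact hp
  -- an empty slot `r` drops out of the sums; otherwise `r` is itself the bound for `p`, and its own
  -- contribution cancels
  by_cases hrm : r.m = 0
  · have hp'' : p ∈ P.take i := hp'.resolve_right fun h => hpm (h ▸ hrm)
    have := key p.dest (fun q hq hqm => hA.2.2 p hp'' q hq hpm hqm) n
    simpa [hrm] using this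
  · have h1 := key r.dest (fun q hq hqm => by
      rw [hrS] at hq
      rcases List.mem_cons.1 hq with rfl | hq
      · exact le_rfl
      · have := hA.2.1
        rw [hrS, List.pairwise_cons] at this
        exact this.1 q hq hrm hqm) n
    have h2 : p.dest ≤ r.dest := by
      rcases hp' with hp' | rfl
      · exact hA.2.2 p hp' r (by rw [hrS]; exact List.mem_cons_self) hpm hrm
      · exact le_rfl
    have h3 := mul_le_mul_of_nonneg_right h2
      (Nat.cast_nonneg (α := ℝ) (totalMass ((P.drop (i + 1)).take n)))
    linarith

theorem pairwise_le_append {A Z D : List Particle} {q : Particle} (hA : A.Pairwise Particle.Le)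
    (hD : D.Pairwise Particle.Le) (hAq : ∀ p ∈ A, p.Le q) (hqD : ∀ p ∈ D, q.Le p)
    (hAD : ∀ p ∈ A, ∀ p' ∈ D, p.Le p') (hZ : ∀ p ∈ Z, p.m = 0) :
    (A ++ q :: Z ++ D).Pairwise Particle.Le := by
  rw [List.append_assoc, List.pairwise_append, List.cons_append, List.pairwise_cons,
    List.pairwise_append]
  refine ⟨hA, ⟨?_, ?_, hD, ?_⟩, ?_⟩
  · intro p hp
    rcases List.mem_append.1 hp with hp | hp
    · exact fun _ h => absurd (hZ p hp) h
    · exact hqD p hp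
  · exact List.pairwise_iff_getElem.2 fun _ _ hn _ _ h => absurd (hZ _ (List.getElem_mem hn)) h
  · exact fun p hp _ _ h => absurd (hZ p hp) h
  · intro p hp p' hp'
    rcases List.mem_cons.1 hp' with rfl | hp'
    · exact hAq p hp
    rcases List.mem_append.1 hp' with hp' | hp'
    · exact fun _ h => absurd (hZ p' hp') h
    · exact hAD p hp p' hp'

theorem isArgminAvg_rightmostCollision (P : List Particle) (i : ℕ) (hi : i < P.length) :
    ∃ a, (rightmostCollision P i).eval = i + a ∧ IsArgminAvg (P.drop i) a :=
  (rightmostCollision_spec P i _ hi (Nat.le_pow_clog (b := 2) (by norm_num) _)).1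

/-- The only order relation that could fail is the one across the border. The merged particle does
not lie to the right of what follows, because its average is least; it does not lie to the left of
what precedes, because the cluster that starts one slot earlier stays in the left half. -/
theorem mergeHalves_solved {k : ℕ} {L R : List Particle} {Y Z : List ℝ}
    (hL : Solved L Y) (hR : Solved R Z) (hLl : L.length = 2 ^ k) (hRl : R.length = 2 ^ k) :
    Solved (mergeHalves (L ++ R)).eval (Y ++ Z) ∧
      (mergeHalves (L ++ R)).eval.length = 2 ^ (k + 1) := by
  obtain ⟨⟨B₁, hB₁, rfl⟩, hLs⟩ := hL
  obtain ⟨⟨B₂, hB₂, rfl⟩, hRs⟩ := hR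
  have hPl : (L ++ R).length = 2 ^ (k + 1) := by rw [List.length_append, pow_succ]; omega
  have hB : List.Forall₂ IsBlock (L ++ R) (B₁ ++ B₂) := List.rel_append hB₁ hB₂
  obtain ⟨⟨i, j, hik, hkj, hij, hjP, hrc, hprev, hev⟩, -⟩ := mergeHalves_spec (L ++ R) k hPl
  have htakeL : ∀ n ≤ 2 ^ k, ((L ++ R).take n).Pairwise Particle.Le := by
    intro n hn
    rw [List.take_append_of_le_length (by omega)]
    exact hLs.sublist (List.take_sublist _ _)
  have hdropR : ((L ++ R).drop (j + 1)).Pairwise Particle.Le := by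
    rw [List.drop_append, List.drop_of_length_le (by omega), List.nil_append]
    exact hRs.sublist (List.drop_sublist _ _)
  rw [← List.flatten_append]
  generalize L ++ R = P at *
  generalize B₁ ++ B₂ = B at *
  obtain ⟨a, ha, hmin⟩ := isArgminAvg_rightmostCollision P i (by omega)
  obtain rfl : j = i + a := by rw [← hrc, ha]
  set S := (P.drop i).take (a + 1) with hS
  have hsub : i + a + 1 - i = a + 1 := by omega
  have hdrop : (P.drop i).drop (a + 1) = P.drop (i + a + 1) := by
    rw [List.drop_drop, add_assoc]
  -- the particles before the merged one
  have hAQ : ∀ p ∈ P.take i, p.m ≠ 0 → ∀ n,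
      p.dest * totalMass ((P.drop i).take n) ≤ totalDest ((P.drop i).take n) := by
    rcases hprev with rfl | hprev
    · simp
    · rcases Nat.eq_zero_or_pos i with rfl | hi
      · simp
      obtain ⟨i, rfl⟩ : ∃ i', i = i' + 1 := ⟨i - 1, by omega⟩
      rw [Nat.add_sub_cancel] at hprev
      obtain ⟨a', ha', hmin'⟩ := isArgminAvg_rightmostCollision P i (by omega)
      exact hmin'.le_totalDest_drop (htakeL _ (by omega))
  have hMD : ∀ p ∈ P.drop (i + a + 1), (mergedParticle S).Le p := by
    have := hmin.mergedParticle_le (by rwa [hdrop])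
    rwa [hdrop] at this
  have hAM : ∀ p ∈ P.take i, p.Le (mergedParticle S) := by
    intro p hp hpm hSm
    have h1 := hAQ p hp hpm (a + 1)
    rw [← hS, ← mergedParticle_dest_mul] at h1
    exact le_of_mul_le_mul_right h1 (by exact_mod_cast Nat.pos_of_ne_zero hSm)
  have hAD : ∀ p ∈ P.take i, ∀ p' ∈ P.drop (i + a + 1), p.Le p' := by
    intro p hp p' hp' hpm hpm'
    by_cases h0 : totalMass S = 0
    · have h1 := totalMass_eq_zero.1 (hmin.totalMass_eq_zero h0) p'
        (List.mem_of_mem_drop (by rwa [hdrop]))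
      exact absurd h1 hpm'
    · exact (hAM p hp hpm h0).trans (hMD p' hp' h0 hpm')
  have hA := htakeL i (by omega)
  have hP : P = P.take i ++ S ++ P.drop (i + a + 1) := by
    rw [List.append_assoc, ← hdrop, hS, List.take_append_drop, List.take_append_drop]
  have hSl : S.length = a + 1 := by
    rw [hS, List.length_take, List.length_drop]; omega
  rw [hev]
  split
  · rw [(performCollisions_spec P i (i + a) _ hPl.le).1, hsub, ← hS]
    refine ⟨⟨⟨B.take i ++ ((B.drop i).take (a + 1)).flatten :: S.tail.map (fun _ => []) ++
      B.drop (i + a + 1), ?_, ?_⟩, ?_⟩, ?_⟩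
    · refine List.rel_append (List.rel_append (List.forall₂_take i hB) (.cons ?_ ?_))
        (List.forall₂_drop _ hB)
      · refine isBlock_mergedParticle (List.forall₂_take _ (List.forall₂_drop _ hB)) ?_
        intro n hn
        have := hmin.le_totalDest n
        rw [hS, List.take_take, min_eq_left (by omega), ← hS]
        exact this
      · rw [List.forall₂_map_left_iff, List.forall₂_map_right_iff, List.forall₂_same]
        exact fun q _ => ⟨rfl, by simp, fun t ht => by
          obtain rfl : t = 0 := Nat.le_zero.1 ht
          simp⟩
    · have h1 : (S.tail.map (fun _ => ([] : List ℝ))).flatten = [] := by simp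
      rw [List.flatten_append, List.flatten_append, List.flatten_cons, h1, List.append_nil,
        ← List.flatten_append, ← List.flatten_append, List.append_assoc, add_assoc i a 1,
        ← List.drop_drop, List.take_append_drop, List.take_append_drop]
    · exact pairwise_le_append hA hdropR hAM hMD hAD fun p hp => by
        obtain ⟨q, -, rfl⟩ := List.mem_map.1 hp
        rfl
    · have h1 := congrArg List.length hP
      simp only [List.length_append, List.length_cons, List.length_map, List.length_tail] at h1 ⊢
      omega
  -- without a collision the array is unchanged, and the merged particle only stands for `q`
  · next hlt =>
    obtain rfl : a = 0 := by omega
    obtain ⟨q, hq⟩ := List.length_eq_one_iff.1 hSl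
    refine ⟨⟨⟨B, hB, rfl⟩, ?_⟩, hPl⟩
    have hqd : q.m ≠ 0 → (mergedParticle S).dest = q.dest := by
      intro hqm
      have h1 := mergedParticle_dest_mul S
      rw [hq] at h1 ⊢
      simp only [totalMass_cons, totalDest_cons, totalMass_nil, totalDest_nil, add_zero] at h1
      exact mul_right_cancel₀ (by exact_mod_cast hqm) h1
    have hqm : (mergedParticle S).m = q.m := by
      rw [hq]; simp [mergedParticle]
    rw [hP, hq]
    refine pairwise_le_append (Z := []) hA hdropR ?_ ?_ hAD (by simp)
    · intro p hp hpm hm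
      have := hAM p hp hpm (by rwa [hqm])
      rwa [hqd hm] at this
    · intro p hp hm hpm
      have := hMD p hp (by rwa [hqm]) hpm
      rwa [hqd hm] at this

end Merging

/-! ### Isotonic regression -/

section Isotonic

/-- The inner product of two arrays. -/
noncomputable def dot (l l' : List ℝ) : ℝ := (List.zipWith (· * ·) l l').sum

@[simp] theorem dot_nil (l : List ℝ) : dot [] l = 0 := by simp [dot]
@[simp] theorem dot_cons (a b : ℝ) (l l' : List ℝ) :
    dot (a :: l) (b :: l') = a * b + dot l l' := by simp [dot]

theorem dot_append {l₁ l₁' l₂ l₂' : List ℝ} (h : l₁.length = l₁'.length) :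
    dot (l₁ ++ l₂) (l₁' ++ l₂') = dot l₁ l₁' + dot l₂ l₂' := by
  rw [dot, List.zipWith_append h, List.sum_append]; rfl

theorem dot_ofFn {d : ℕ} (f g : Fin d → ℝ) :
    dot (List.ofFn f) (List.ofFn g) = ∑ i, f i * g i := by
  rw [dot, ← List.sum_ofFn]
  congr 1
  exact List.ext_getElem (by simp) (by simp)

theorem dot_replicate (c : ℝ) (l : List ℝ) : dot (List.replicate l.length c) l = c * l.sum := by
  induction l with
  | nil => simp
  | cons a l ih => simp [List.replicate_succ, ih, mul_add]

theorem dot_replicate_right (l : List ℝ) (c : ℝ) :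
    dot l (List.replicate l.length c) = c * l.sum := by
  induction l with
  | nil => simp
  | cons a l ih => simp [List.replicate_succ, ih, mul_add, mul_comm]

/-- Summation by parts: a sequence whose partial sums, beginning with `acc`, stay above the
partial sums of the constant sequence `c` has a small inner product with a sorted sequence. -/
theorem dot_le_of_le_sum_take (c : ℝ) (h Z : List ℝ) (acc lo hi : ℝ) (hl : h.length = Z.length)
    (hZ : Z.Pairwise (· ≤ ·)) (hlo : ∀ z ∈ Z, lo ≤ z) (hhi : ∀ z ∈ Z, z ≤ hi) (hlh : lo ≤ hi)
    (hs : ∀ t ≤ h.length, c * t ≤ acc + (h.take t).sum) :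
    dot h Z ≤ c * Z.sum + (acc + h.sum - c * h.length) * hi - acc * lo := by
  induction h generalizing Z acc lo with
  | nil =>
    obtain rfl : Z = [] := List.length_eq_zero_iff.1 hl.symm
    have := hs 0 le_rfl
    simp at this ⊢
    nlinarith
  | cons a h ih =>
    obtain ⟨z, Z, rfl⟩ : ∃ z Z', Z = z :: Z' := by
      cases Z with
      | nil => simp at hl
      | cons z Z => exact ⟨z, Z, rfl⟩
    rw [List.pairwise_cons] at hZ
    have h0 : 0 ≤ acc := by simpa using hs 0 (Nat.zero_le _)
    have h1 := ih Z (acc + a - c) z (by simpa using hl) hZ.2 hZ.1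
      (fun y hy => hhi y (List.mem_cons_of_mem _ hy)) (hhi z List.mem_cons_self) (fun t ht => by
        have := hs (t + 1) (by simpa using ht)
        simp only [List.take_succ_cons, List.sum_cons] at this
        push_cast at this
        linarith)
    have h2 := mul_le_mul_of_nonneg_left (hlo z List.mem_cons_self) h0
    rw [dot_cons, List.sum_cons, List.sum_cons, List.length_cons]
    push_cast
    linarith

theorem IsBlock.dot_le {p : Particle} {b : List ℝ} (hb : IsBlock p b) {Z : List ℝ}
    (hl : b.length = Z.length) (hZ : Z.Pairwise (· ≤ ·)) :
    dot b Z ≤ dot (List.replicate p.m p.dest) Z := by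
  have hM : ∀ z ∈ Z, |z| ≤ (Z.map abs).sum := fun z hz =>
    List.single_le_sum (by simp) _ (List.mem_map_of_mem hz)
  have h0 : 0 ≤ (Z.map abs).sum := List.sum_nonneg (by simp)
  have h1 := dot_le_of_le_sum_take p.dest b Z 0 (-(Z.map abs).sum) (Z.map abs).sum hl hZ
    (fun z hz => (abs_le.1 (hM z hz)).1) (fun z hz => (abs_le.1 (hM z hz)).2) (by linarith)
    (fun t ht => by simpa using hb.le_sum_take t (hb.length_eq ▸ ht))
  rw [← hb.length_eq, hl, dot_replicate]
  rw [hb.sum_eq, hb.length_eq] at h1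
  linarith

theorem finalPositions_cons (p : Particle) (P : List Particle) :
    finalPositions (p :: P) = List.replicate p.m p.dest ++ finalPositions P := rfl

theorem length_finalPositions (P : List Particle) :
    (finalPositions P).length = totalMass P := by
  induction P with
  | nil => rfl
  | cons p P ih => simp [finalPositions_cons, ih]

theorem dot_flatten_le {P : List Particle} {B : List (List ℝ)} (h : List.Forall₂ IsBlock P B)
    (Z : List ℝ) (hl : B.flatten.length = Z.length) (hZ : Z.Pairwise (· ≤ ·)) :
    dot B.flatten Z ≤ dot (finalPositions P) Z := by
  induction h generalizing Z with
  | nil => simp [finalPositions]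
  | cons hb _ ih =>
    rename_i p b P B _
    rw [List.flatten_cons, List.length_append] at hl
    rw [List.flatten_cons, finalPositions_cons, ← List.take_append_drop b.length Z,
      dot_append (by rw [List.length_take]; omega),
      dot_append (by rw [List.length_take, List.length_replicate, hb.length_eq]
                     have := hb.length_eq
                     omega)]
    exact add_le_add
      (hb.dot_le (by rw [List.length_take]; omega) (hZ.sublist (List.take_sublist _ _)))
      (ih _ (by rw [List.length_drop]; omega) (hZ.sublist (List.drop_sublist _ _)))

theorem dot_flatten_finalPositions {P : List Particle} {B : List (List ℝ)}
    (h : List.Forall₂ IsBlock P B) :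
    dot B.flatten (finalPositions P) = dot (finalPositions P) (finalPositions P) := by
  induction h with
  | nil => simp [finalPositions]
  | cons hb _ ih =>
    rename_i p b P B _
    rw [List.flatten_cons, finalPositions_cons, dot_append (by simp [hb.length_eq]),
      dot_append rfl, ih, ← hb.length_eq, dot_replicate_right, hb.sum_eq, ← hb.length_eq]
    have := dot_replicate p.dest (List.replicate b.length p.dest)
    rw [List.length_replicate] at this
    rw [this, List.sum_replicate, nsmul_eq_mul]
    ring

theorem pairwise_finalPositions {P : List Particle} (h : P.Pairwise Particle.Le) :
    (finalPositions P).Pairwise (· ≤ ·) := by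
  rw [finalPositions, List.pairwise_flatMap]
  refine ⟨fun p _ => List.pairwise_replicate.2 (Or.inr le_rfl), h.imp ?_⟩
  intro p q hpq a ha b hb
  rw [List.mem_replicate] at ha hb
  rw [ha.2, hb.2]
  exact hpq ha.1 hb.1

/-- A solved array describes the projection of `y` onto the cone of monotone vectors. -/
theorem Solved.exists_projection {d : ℕ} {P : List Particle} {y : Fin d → ℝ}
    (h : Solved P (List.ofFn y)) :
    ∃ u : Fin d → ℝ, finalPositions P = List.ofFn u ∧ Monotone u ∧
      (∀ z : Fin d → ℝ, Monotone z → ∑ i, y i * z i ≤ ∑ i, u i * z i) ∧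
      ∑ i, y i * u i = ∑ i, u i * u i := by
  obtain ⟨⟨B, hB, hY⟩, hs⟩ := h
  have hlen : (finalPositions P).length = d := by
    rw [length_finalPositions, ← length_flatten_of_isBlock hB, hY, List.length_ofFn]
  obtain ⟨u, hu⟩ : ∃ u : Fin d → ℝ, finalPositions P = List.ofFn u := by
    subst hlen
    exact ⟨(finalPositions P).get, (List.ofFn_get _).symm⟩
  refine ⟨u, hu, ?_, fun z hz => ?_, ?_⟩
  · have := pairwise_finalPositions hs
    rw [hu, List.pairwise_ofFn] at this
    exact monotone_iff_forall_lt.2 fun i j hij => this hij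
  · have := dot_flatten_le hB (List.ofFn z) (by rw [hY]; simp)
      (List.pairwise_ofFn.2 fun i j hij => hz hij.le)
    rwa [hY, hu, dot_ofFn, dot_ofFn] at this
  · have := dot_flatten_finalPositions hB
    rwa [hY, hu, dot_ofFn, dot_ofFn] at this

end Isotonic

/-! ### The proximal mapping of the regularizer -/

section Prox

variable {d : ℕ}

/-- The initial velocities. -/
noncomputable def velocity (d : ℕ) (i : Fin d) : ℝ :=
  ((d : ℝ) - 2 * ((i : ℕ) + 1 : ℝ) + 1) / ((d : ℝ) - 1)

/-- On sorted vectors the regularizer is linear, and the velocities are its negative gradient. -/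
theorem weightSharingReg_of_monotone (hd : 2 ≤ d) (z : EuclideanSpace ℝ (Fin d))
    (hz : ∀ i j : Fin d, i ≤ j → z i ≤ z j) :
    weightSharingReg d z = -∑ i, velocity d i * z i := by
  have hd' : (d : ℝ) - 1 ≠ 0 := by
    have : (2 : ℝ) ≤ d := by exact_mod_cast hd
    linarith
  have h1 : ∑ i : Fin d, ∑ j ∈ Finset.univ.filter (fun j : Fin d => j < i), |z i - z j| =
      ∑ i : Fin d, ∑ j ∈ Finset.univ.filter (fun j : Fin d => j < i), (z i - z j) := by
    refine Finset.sum_congr rfl fun i _ => Finset.sum_congr rfl fun j hj => ?_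
    rw [Finset.mem_filter] at hj
    exact abs_of_nonneg (sub_nonneg.2 (hz j i hj.2.le))
  have h2 : ∑ i : Fin d, ∑ j ∈ Finset.univ.filter (fun j : Fin d => j < i), z i =
      ∑ i : Fin d, (i : ℕ) * z i := by
    refine Finset.sum_congr rfl fun i _ => ?_
    rw [Finset.sum_const, nsmul_eq_mul, Finset.filter_gt_eq_Iio, Fin.card_Iio]
  have h3 : ∑ i : Fin d, ∑ j ∈ Finset.univ.filter (fun j : Fin d => j < i), z j =
      ∑ i : Fin d, ((d : ℝ) - 1 - (i : ℕ)) * z i := by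
    rw [Finset.sum_comm' (t' := Finset.univ) (s' := fun j => Finset.univ.filter (fun i => j < i))
      (by simp)]
    refine Finset.sum_congr rfl fun i _ => ?_
    rw [Finset.sum_const, nsmul_eq_mul, Finset.filter_lt_eq_Ioi, Fin.card_Ioi,
      Nat.cast_sub (by omega), Nat.cast_sub (by omega)]
    simp
  rw [weightSharingReg, h1]
  simp only [Finset.sum_sub_distrib]
  rw [h2, h3, ← Finset.sum_sub_distrib, Finset.mul_sum, ← Finset.sum_neg_distrib]
  refine Finset.sum_congr rfl fun i _ => ?_
  rw [velocity]
  field_simp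
  ring

theorem weightSharingReg_eq_sum_univ (z : EuclideanSpace ℝ (Fin d)) :
    weightSharingReg d z = 1 / ((d : ℝ) - 1) * ((∑ i, ∑ j, |z i - z j|) / 2) := by
  have h : ∑ i, ∑ j, |z i - z j| =
      ∑ i, ∑ j, ((if j < i then |z i - z j| else 0) + (if i < j then |z i - z j| else 0)) := by
    refine Finset.sum_congr rfl fun i _ => Finset.sum_congr rfl fun j _ => ?_
    rcases lt_trichotomy i j with h | rfl | h
    · simp [h, h.not_gt]
    · simp
    · simp [h, h.not_gt]
  simp only [Finset.sum_add_distrib] at h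
  rw [Finset.sum_comm (f := fun i j => if i < j then |z i - z j| else 0)] at h
  simp only [abs_sub_comm] at h
  rw [weightSharingReg]
  congr 1
  simp only [Finset.sum_filter]
  rw [eq_div_iff two_ne_zero, h, mul_two]

theorem weightSharingReg_perm (z : EuclideanSpace ℝ (Fin d)) (σ : Equiv.Perm (Fin d)) :
    weightSharingReg d (WithLp.toLp 2 fun i => z (σ i)) = weightSharingReg d z := by
  rw [weightSharingReg_eq_sum_univ, weightSharingReg_eq_sum_univ]
  congr 2
  simp only
  rw [Equiv.sum_comp σ (fun i => ∑ j, |z i - z (σ j)|)]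
  exact Finset.sum_congr rfl fun i _ => Equiv.sum_comp σ (fun j => |z i - z j|)

theorem weightSharingReg_midpoint_le (hd : 2 ≤ d) (z u : EuclideanSpace ℝ (Fin d)) :
    weightSharingReg d (WithLp.toLp 2 fun i => (z i + u i) / 2) ≤
      (weightSharingReg d z + weightSharingReg d u) / 2 := by
  have hd' : 0 ≤ 1 / ((d : ℝ) - 1) := by
    have : (2 : ℝ) ≤ d := by exact_mod_cast hd
    exact one_div_nonneg.2 (by linarith)
  rw [weightSharingReg, weightSharingReg, weightSharingReg, ← mul_add, mul_div_assoc]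
  refine mul_le_mul_of_nonneg_left ?_ hd'
  rw [← Finset.sum_add_distrib, Finset.sum_div]
  refine Finset.sum_le_sum fun i _ => ?_
  rw [← Finset.sum_add_distrib, Finset.sum_div]
  refine Finset.sum_le_sum fun j _ => ?_
  have h1 : (z i + u i) / 2 - (z j + u j) / 2 = ((z i - z j) + (u i - u j)) / 2 := by ring
  simp only
  rw [h1, abs_div, abs_two]
  exact div_le_div_of_nonneg_right (abs_add_le _ _) (by norm_num)

theorem EuclideanSpace.norm_sub_sq_eq_sum (z x : EuclideanSpace ℝ (Fin d)) :
    ‖z - x‖ ^ 2 = ∑ i, (z i - x i) ^ 2 := by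
  simp [EuclideanSpace.norm_sq_eq]

/-- The projection `u` of `x + v` onto the cone of sorted vectors minimizes the objective: sorting
a competitor does not increase its objective, and on the cone the regularizer is linear. -/
theorem prox_objective_le (hd : 2 ≤ d) (x u : EuclideanSpace ℝ (Fin d))
    (hx : ∀ i j : Fin d, i ≤ j → x i ≤ x j) (hu : ∀ i j : Fin d, i ≤ j → u i ≤ u j)
    (hz : ∀ z : Fin d → ℝ, Monotone z →
      ∑ i, (x i + velocity d i) * z i ≤ ∑ i, u i * z i)
    (huu : ∑ i, (x i + velocity d i) * u i = ∑ i, u i * u i) (z : EuclideanSpace ℝ (Fin d)) :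
    weightSharingReg d u + (1 / 2) * ‖u - x‖ ^ 2 ≤
      weightSharingReg d z + (1 / 2) * ‖z - x‖ ^ 2 := by
  set σ : Equiv.Perm (Fin d) := Tuple.sort (fun i => z i) with hσ
  have hmono : Monotone fun i => z (σ i) := Tuple.monotone_sort (fun i => z i)
  rw [← weightSharingReg_perm z σ, weightSharingReg_of_monotone hd u hu,
    weightSharingReg_of_monotone hd _ (fun i j hij => hmono hij),
    EuclideanSpace.norm_sub_sq_eq_sum, EuclideanSpace.norm_sub_sq_eq_sum]
  have hre : ∑ i, z i * x i ≤ ∑ i, z (σ i) * x i := by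
    have h1 : Monovary (fun i => z (σ i)) (fun i => x i) :=
      Monotone.monovary hmono fun i j hij => hx i j hij
    have h2 := h1.sum_comp_perm_mul_le_sum_mul (σ := σ⁻¹)
    simpa using h2
  have hsq : ∑ i, z (σ i) ^ 2 = ∑ i, z i ^ 2 := Equiv.sum_comp σ (fun i => z i ^ 2)
  have h3 := hz _ hmono
  have h4 : 0 ≤ ∑ i, (z (σ i) - u i) ^ 2 := Finset.sum_nonneg fun i _ => sq_nonneg _
  simp only [sub_sq, add_mul, Finset.sum_add_distrib, Finset.sum_sub_distrib, mul_assoc,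
    ← Finset.mul_sum] at h3 h4 huu ⊢
  have h5 : ∑ i, z (σ i) * u i = ∑ i, u i * z (σ i) :=
    Finset.sum_congr rfl fun i _ => mul_comm _ _
  have h6 : ∑ i, z (σ i) * x i = ∑ i, x i * z (σ i) :=
    Finset.sum_congr rfl fun i _ => mul_comm _ _
  have h7 : ∑ i, u i * x i = ∑ i, x i * u i :=
    Finset.sum_congr rfl fun i _ => mul_comm _ _
  have h8 : ∑ i, u i * u i = ∑ i, u i ^ 2 :=
    Finset.sum_congr rfl fun i _ => (sq _).symm
  linarith

theorem isProx_of_projection (hd : 2 ≤ d) (x u : EuclideanSpace ℝ (Fin d))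
    (hx : ∀ i j : Fin d, i ≤ j → x i ≤ x j) (hu : ∀ i j : Fin d, i ≤ j → u i ≤ u j)
    (hz : ∀ z : Fin d → ℝ, Monotone z →
      ∑ i, (x i + velocity d i) * z i ≤ ∑ i, u i * z i)
    (huu : ∑ i, (x i + velocity d i) * u i = ∑ i, u i * u i) :
    IsProx (weightSharingReg d) x u := by
  intro z hne
  by_contra! hle
  -- by strong convexity, the midpoint of two minimizers would have a smaller objective
  have h1 := prox_objective_le hd x u hx hu hz huu (WithLp.toLp 2 fun i => (z i + u i) / 2)
  have h2 := weightSharingReg_midpoint_le hd z u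
  have h3 : 0 < ‖z - u‖ ^ 2 := by
    have := norm_pos_iff.2 (sub_ne_zero.2 hne)
    positivity
  have h4 : ‖(WithLp.toLp 2 fun i => (z i + u i) / 2) - x‖ ^ 2 =
      (‖z - x‖ ^ 2 + ‖u - x‖ ^ 2) / 2 - ‖z - u‖ ^ 2 / 4 := by
    simp only [EuclideanSpace.norm_sub_sq_eq_sum]
    rw [← Finset.sum_add_distrib, Finset.sum_div, Finset.sum_div, ← Finset.sum_sub_distrib]
    refine Finset.sum_congr rfl fun i _ => ?_
    ring
  rw [h4] at h1
  linarith

end Prox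

/-! ### The divide and conquer recursion -/

section Recursion

/-- With `W` and `D` for the bounds on work and depth of the recursion, `2 W(k) + 24 (k+1) 2^(k+1)`
is at most `W(k+1)`, and `D(k) + 33 (k+1)²` is at most `D(k+1)`. In the input each particle has
mass `1`, and the slots that are padding have mass `0`. -/
theorem searchCollisionsPow_spec (k : ℕ) (P : List Particle) (hP : P.length = 2 ^ k)
    (hm : ∀ q ∈ P, q.m ≤ 1) :
    Solved (searchCollisionsPow k P).eval (finalPositions P) ∧
      (searchCollisionsPow k P).eval.length = 2 ^ k ∧
      (searchCollisionsPow k P).work ≤ 24 * k ^ 2 * 2 ^ k ∧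
      (searchCollisionsPow k P).depth ≤ 33 * k ^ 3 := by
  induction k generalizing P with
  | zero =>
    obtain ⟨q, rfl⟩ := List.length_eq_one_iff.1 hP
    have hq : q.m ≤ 1 := hm q List.mem_cons_self
    refine ⟨⟨⟨[List.replicate q.m q.dest], .cons ⟨by simp, ?_, fun t ht => ?_⟩ .nil, ?_⟩, ?_⟩,
      rfl, by simp [searchCollisionsPow, Par.work], by simp [searchCollisionsPow, Par.depth]⟩
    · rw [List.sum_replicate, nsmul_eq_mul, mul_comm]
    · rw [List.take_replicate, List.sum_replicate, nsmul_eq_mul, mul_comm, min_eq_left ht]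
    · simp [finalPositions, Particle.dest]
    · exact List.pairwise_singleton _ _
  | succ k ih =>
    rw [pow_succ] at hP
    have hL : (P.take (2 ^ k)).length = 2 ^ k := by rw [List.length_take]; omega
    have hR : (P.drop (2 ^ k)).length = 2 ^ k := by rw [List.length_drop]; omega
    obtain ⟨l1, l2, l3, l4⟩ := ih _ hL fun q hq => hm q (List.mem_of_mem_take hq)
    obtain ⟨r1, r2, r3, r4⟩ := ih _ hR fun q hq => hm q (List.mem_of_mem_drop hq)
    obtain ⟨m1, m2⟩ := mergeHalves_solved l1 r1 l2 r2
    obtain ⟨-, c1, c2⟩ := mergeHalves_spec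
      ((searchCollisionsPow k (P.take (2 ^ k))).eval ++
        (searchCollisionsPow k (P.drop (2 ^ k))).eval) k (by
        rw [List.length_append, l2, r2, pow_succ, mul_two])
    have hfin : finalPositions (P.take (2 ^ k)) ++ finalPositions (P.drop (2 ^ k)) =
        finalPositions P := by
      rw [finalPositions, finalPositions, ← List.flatMap_append, List.take_append_drop]
      rfl
    rw [hfin] at m1
    refine ⟨m1, m2, ?_, ?_⟩
    · rw [searchCollisionsPow, Par.work]
      refine (add_le_add (add_le_add l3 r3) c1).trans ?_
      have : 24 * k ^ 2 * 2 ^ k + 24 * k ^ 2 * 2 ^ k + 24 * (k + 1) * 2 ^ (k + 1) =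
          24 * (k ^ 2 + k + 1) * 2 ^ (k + 1) := by ring
      rw [this]
      refine Nat.mul_le_mul_right _ ?_
      nlinarith
    · rw [searchCollisionsPow, Par.depth]
      have : max (searchCollisionsPow k (P.take (2 ^ k))).depth
        (searchCollisionsPow k (P.drop (2 ^ k))).depth ≤ 33 * k ^ 3 := max_le l4 r4
      refine (add_le_add this c2).trans ?_
      nlinarith [Nat.zero_le (k ^ 2), Nat.zero_le k]

theorem searchCollisions_spec (P : List Particle) (hm : ∀ q ∈ P, q.m ≤ 1) :
    Solved (searchCollisions P).eval (finalPositions P) ∧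
      (searchCollisions P).work ≤ 3 * (2 ^ Nat.clog 2 P.length - P.length) +
        24 * Nat.clog 2 P.length ^ 2 * 2 ^ Nat.clog 2 P.length ∧
      (searchCollisions P).depth ≤ 3 + 33 * Nat.clog 2 P.length ^ 3 := by
  obtain ⟨z1, z2, z3⟩ := parMap_spec (fun _ : ℕ => do
    let x ← Par.prim (.rstore 0)
    let v ← Par.prim (.rstore 0)
    let m ← Par.prim (.nstore 0)
    pure (Particle.mk x v m)) (w := 3) (δ := 3) (by simp) (by simp)
    (List.range (2 ^ Nat.clog 2 P.length - P.length))
  simp only [Par.eval_bind, Par.eval_prim, Prim.eval, Par.eval_pure, List.map_const',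
    List.length_range] at z1 z2
  have hle := Nat.le_pow_clog (b := 2) (by norm_num) P.length
  obtain ⟨h1, -, h3, h4⟩ := searchCollisionsPow_spec (Nat.clog 2 P.length)
    (P ++ List.replicate (2 ^ Nat.clog 2 P.length - P.length) (Particle.mk 0 0 0))
    (by rw [List.length_append, List.length_replicate]; omega) (by
      intro q hq
      rcases List.mem_append.1 hq with hq | hq
      · exact hm q hq
      · rw [(List.mem_replicate.1 hq).2]; exact Nat.zero_le _)
  have hfin : finalPositions
      (P ++ List.replicate (2 ^ Nat.clog 2 P.length - P.length) (Particle.mk 0 0 0)) =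
      finalPositions P := by
    rw [finalPositions, List.flatMap_append,
      (List.flatMap_eq_nil_iff (l := List.replicate _ _)).2, List.append_nil]
    · rfl
    intro q hq
    rw [(List.mem_replicate.1 hq).2]
    rfl
  rw [hfin] at h1
  refine ⟨?_, ?_, ?_⟩
  · simpa only [searchCollisions, Par.eval_bind, z1] using h1
  · simp only [searchCollisions, Par.work_bind, z1]
    exact add_le_add z2 h3
  · simp only [searchCollisions, Par.depth_bind, z1]
    exact add_le_add z3 h4

theorem finalPositions_initialParticles {d : ℕ} (x : EuclideanSpace ℝ (Fin d)) :
    finalPositions (initialParticles x) = List.ofFn fun i => x i + velocity d i := by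
  have h : ∀ l : List Particle, (∀ q ∈ l, q.m = 1) → finalPositions l = l.map Particle.dest := by
    intro l hl
    induction l with
    | nil => rfl
    | cons q l ih =>
      rw [finalPositions_cons, hl q List.mem_cons_self,
        ih fun p hp => hl p (List.mem_cons_of_mem _ hp)]
      rfl
  rw [h _ (by
    intro q hq
    obtain ⟨i, rfl⟩ := (List.mem_ofFn' _ _).1 hq
    rfl), initialParticles, List.map_ofFn]
  rfl

theorem two_pow_clog_le {d : ℕ} (hd : 2 ≤ d) : 2 ^ Nat.clog 2 d ≤ 2 * d := by
  have h := Nat.pow_pred_clog_lt_self (b := 2) (by norm_num) (x := d) (by omega)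
  have h1 : 0 < Nat.clog 2 d := Nat.clog_pos (by norm_num) hd
  obtain ⟨k, hk⟩ := Nat.exists_eq_succ_of_ne_zero h1.ne'
  rw [hk] at h ⊢
  rw [pow_succ]
  simp only [Nat.succ_eq_add_one, Nat.pred_eq_sub_one, Nat.add_sub_cancel] at h
  omega

theorem one_le_logb_two {d : ℕ} (hd : 2 ≤ d) : 1 ≤ Real.logb 2 d := by
  rw [Real.le_logb_iff_rpow_le (by norm_num) (by positivity), Real.rpow_one]
  exact_mod_cast hd

theorem clog_le_two_mul_logb {d : ℕ} (hd : 2 ≤ d) : (Nat.clog 2 d : ℝ) ≤ 2 * Real.logb 2 d := by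
  have hd' : (0 : ℝ) < d := by positivity
  have h1 : ((2 : ℝ) ^ Nat.clog 2 d) ≤ 2 * d := by exact_mod_cast two_pow_clog_le hd
  have h2 : (Nat.clog 2 d : ℝ) ≤ Real.logb 2 (2 * d) := by
    rw [Real.le_logb_iff_rpow_le (by norm_num) (by positivity), Real.rpow_natCast]
    exact h1
  rw [Real.logb_mul (by norm_num) hd'.ne', Real.logb_self_eq_one (by norm_num)] at h2
  linarith [one_le_logb_two hd]

end Recursion

theorem mainTheorem4 :
    ∃ C : ℝ, 0 < C ∧ ∀ (d : ℕ), 2 ≤ d → ∀ x : EuclideanSpace ℝ (Fin d),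
      (∀ i j : Fin d, i ≤ j → x i ≤ x j) →
        (∃ u : EuclideanSpace ℝ (Fin d), IsProx (weightSharingReg d) x u ∧
          finalPositions (searchCollisions (initialParticles x)).eval =
            List.ofFn (fun i : Fin d => u i)) ∧
        ((searchCollisions (initialParticles x)).work : ℝ) ≤
          C * ((d : ℝ) * Real.logb 2 (d : ℝ) ^ 2) ∧
        ((searchCollisions (initialParticles x)).depth : ℝ) ≤ C * Real.logb 2 (d : ℝ) ^ 3 ∧
        ∀ p : ℕ, 1 ≤ p → ∃ T : ℕ,
          Par.RunsIn p (searchCollisions (initialParticles x)) T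
            (searchCollisions (initialParticles x)).eval ∧
          (T : ℝ) ≤ C * ((d : ℝ) * Real.logb 2 (d : ℝ) ^ 2 / (p : ℝ) +
            Real.logb 2 (d : ℝ) ^ 3) := by
  -- with `k = ⌈log₂ d⌉ ≤ 2 log₂ d` and `2 ^ k ≤ 2 d`, the work is at most
  -- `3 d + 24 k² 2 ^ k ≤ 195 d log₂² d` and the depth at most `3 + 33 k³ ≤ 267 log₂³ d`
  refine ⟨267, by norm_num, fun d hd x hx => ?_⟩
  obtain ⟨hs, hw, hδ⟩ := searchCollisions_spec (initialParticles x) (by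
    intro q hq
    obtain ⟨i, rfl⟩ := (List.mem_ofFn' _ _).1 hq
    exact le_rfl)
  have hlen : (initialParticles x).length = d := by simp [initialParticles]
  rw [hlen] at hw hδ
  rw [finalPositions_initialParticles] at hs
  have hL := one_le_logb_two hd
  have hk := clog_le_two_mul_logb hd
  have h2k := two_pow_clog_le hd
  set L := Real.logb 2 (d : ℝ)
  set k := Nat.clog 2 d
  have hL0 : 0 ≤ L := by linarith
  have hd0 : (0 : ℝ) ≤ d := Nat.cast_nonneg d
  have hwork : ((searchCollisions (initialParticles x)).work : ℝ) ≤ 267 * (d * L ^ 2) := by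
    have h1 : (searchCollisions (initialParticles x)).work ≤ 3 * d + 24 * k ^ 2 * (2 * d) :=
      hw.trans (add_le_add (by omega) (Nat.mul_le_mul_left _ h2k))
    have h2 : ((searchCollisions (initialParticles x)).work : ℝ) ≤
        3 * d + 24 * k ^ 2 * (2 * d) := by exact_mod_cast h1
    have h3 : (k : ℝ) ^ 2 ≤ 4 * L ^ 2 := by
      have := pow_le_pow_left₀ (Nat.cast_nonneg k) hk 2
      linarith [mul_pow 2 L 2]
    have h4 : (1 : ℝ) ≤ L ^ 2 := one_le_pow₀ hL
    have h5 := mul_le_mul_of_nonneg_left h3 hd0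
    have h6 := mul_le_mul_of_nonneg_left h4 hd0
    linarith
  have hdepth : ((searchCollisions (initialParticles x)).depth : ℝ) ≤ 267 * L ^ 3 := by
    have h2 : ((searchCollisions (initialParticles x)).depth : ℝ) ≤ 3 + 33 * k ^ 3 := by
      exact_mod_cast hδ
    have h3 : (k : ℝ) ^ 3 ≤ 8 * L ^ 3 := by
      have := pow_le_pow_left₀ (Nat.cast_nonneg k) hk 3
      linarith [mul_pow 2 L 3]
    have h4 : (1 : ℝ) ≤ L ^ 3 := one_le_pow₀ hL
    linarith
  refine ⟨?_, hwork, hdepth, fun p hp => ?_⟩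
  · obtain ⟨u, hu, hmono, hz, huu⟩ := hs.exists_projection
    exact ⟨WithLp.toLp 2 u,
      isProx_of_projection hd x _ hx (fun i j hij => hmono hij) hz huu, hu⟩
  · obtain ⟨T, hT, hle⟩ := Par.exists_runsIn hp (searchCollisions (initialParticles x))
    refine ⟨T, hT, hle.trans ?_⟩
    rw [mul_add, ← mul_div_assoc]
    exact add_le_add (div_le_div_of_nonneg_right hwork (Nat.cast_nonneg p)) hdepth
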